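/- **Proposition 1.2 (Sharp bilinear trace, flat).** Let $I=[0,1]$. Fix a real-valued, radial function $\chi\in C^\infty(\mathbb R^2)$ supported in $\{\tfrac12\le|\xi|\le 2\}$ with $\sum_{k\in\mathbb Z}\chi(2^{-k}\xi)=1$ for all $\xi\neq 0$. For an integrable function $f$ on $\mathbb R^2$, with Fourier transform $\hat f(\xi)=\int_{\mathbb R^2} e^{-2\pi i x\cdot\xi}f(x)\,dx$, define the Littlewood–Paley projections by $(P_kf)^{\wedge}(\xi)=\chi(2^{-k}\xi)\hat f(\xi)$, $k\in\mathbb Z$, and $P_{<0}=\sum_{k<0}P_k$ (the Fourier multiplier with symbol $\sum_{k<0}\chi(2^{-k}\xi)$), and let $$\|f\|_{B^0_{2,1}(\mathbb R^2)}=\sum_{k\ge 0}\|P_kf\|_{L^2(\mathbb R^2)}+\|P_{<0}f\|_{L^2(\mathbb R^2)}\in[0,\infty].$$ For a smooth function $g=g(t,x)$ on $I\times\mathbb R^2$ let $$\|g\|_{H^1(I\times\mathbb R^2)}=\Big(\int_0^1\!\int_{\mathbb R^2}\big(|g|^2+|\partial_tg|^2+|\nabla_x g|^2\big)\,dx\,dt\Big)^{1/2}\in[0,\infty].$$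 Then there is a constant $C$, depending only on $\chi$, such that for all smooth complex-valued functions $g,h$ on $I\times\mathbb R^2$ (smooth up to the boundary $t=0,1$), $$\Big\|\int_I\partial_tg\cdot h\,dt\Big\|_{B^0_{2,1}(\mathbb R^2)}\le C\,\|g\|_{H^1(I\times\mathbb R^2)}\,\|h\|_{H^1(I\times\mathbb R^2)}.$$ Here, if both norms on the right are finite, the function $x\mapsto\int_I\partial_tg(t,x)\,h(t,x)\,dt$ is integrable on $\mathbb R^2$, so that its Besov norm is defined as above. If one of the norms on the right is infinite, the right-hand side is read with $0\cdot\infty=0$ (and the inequality is trivial). -/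

import Mathlib

open MeasureTheory Set
open scoped ENNReal NNReal ContDiff FourierTransform

noncomputable section

namespace SharpTrace

/-- The Euclidean plane `ℝ²`. -/
abbrev Plane : Type := EuclideanSpace ℝ (Fin 2)

/-- The slab `I × ℝ²` with `I = [0,1]`. -/
def slab : Set (ℝ × Plane) := Icc (0 : ℝ) 1 ×ˢ (univ : Set Plane)

/-- The partial derivative `∂_t g`, one-sided at the end points of `I = [0,1]`. -/
def partialT (g : ℝ × Plane → ℂ) (p : ℝ × Plane) : ℂ :=
  derivWithin (fun s : ℝ => g (s, p.2)) (Icc (0 : ℝ) 1) p.1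

/-- The partial derivative `∂_{x^i} g`. -/
def partialX (i : Fin 2) (g : ℝ × Plane → ℂ) (p : ℝ × Plane) : ℂ :=
  fderiv ℝ (fun y : Plane => g (p.1, y)) p.2 (EuclideanSpace.single i (1 : ℝ))

/-- The norm of `H¹(I × ℝ²)`, with values in `[0,∞]`: the square root of
`∫_{I × ℝ²} (|g|² + |∂_t g|² + |∇g|²) dt dx`. -/
def h1Norm (g : ℝ × Plane → ℂ) : ℝ≥0∞ :=
  (∫⁻ p in slab, (‖g p‖ₑ ^ 2 + ‖partialT g p‖ₑ ^ 2 + ∑ i : Fin 2, ‖partialX i g p‖ₑ ^ 2))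
    ^ (1 / 2 : ℝ)

/-- `χ` generates a Littlewood–Paley decomposition: it is a real, radial, smooth function, supported
in the annulus `1/2 ≤ |ξ| ≤ 2`, with `∑_{k ∈ ℤ} χ(2^{-k} ξ) = 1` for all `ξ ≠ 0`. -/
structure IsLPCutoff (χ : Plane → ℝ) : Prop where
  smooth : ContDiff ℝ ∞ χ
  radial : ∀ ξ η : Plane, ‖ξ‖ = ‖η‖ → χ ξ = χ η
  support_subset : Function.support χ ⊆ {ξ : Plane | 1 / 2 ≤ ‖ξ‖ ∧ ‖ξ‖ ≤ 2}
  hasSum_one : ∀ ξ : Plane, ξ ≠ 0 → HasSum (fun k : ℤ => χ ((2 : ℝ) ^ (-k) • ξ)) 1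

/-- The symbol `∑_{k ∈ J} χ(2^{-k} ξ)` of `P_J`; at each `ξ` only finitely many terms are nonzero. -/
def lpSymbol (χ : Plane → ℝ) (J : Set ℤ) (ξ : Plane) : ℝ :=
  ∑' k : J, χ ((2 : ℝ) ^ (-(k : ℤ)) • ξ)

/-- The Littlewood–Paley projection `P_J = ∑_{k ∈ J} P_k`, acting on integrable functions as the
Fourier multiplier with symbol `∑_{k ∈ J} χ(2^{-k} ξ)`. -/
def lpProj (χ : Plane → ℝ) (J : Set ℤ) (f : Plane → ℂ) : Plane → ℂ :=
  𝓕⁻ (fun ξ : Plane => (lpSymbol χ J ξ : ℂ) * 𝓕 f ξ)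

/-- The inhomogeneous Besov norm of `B^θ_{2,1}(ℝ²)`, with values in `[0,∞]`, of an integrable
function: `∑_{k ≥ 0} 2^{kθ} ‖P_k f‖_{L²} + ‖P_{<0} f‖_{L²}`. -/
def besovNorm (χ : Plane → ℝ) (θ : ℝ) (f : Plane → ℂ) : ℝ≥0∞ :=
  (∑' k : ℕ, (2 : ℝ≥0∞) ^ ((k : ℝ) * θ) * eLpNorm (lpProj χ {(k : ℤ)} f) 2 volume)
    + eLpNorm (lpProj χ (Iio (0 : ℤ)) f) 2 volume

/-- The function `x ↦ ∫_I ∂_t g(t,x) · h(t,x) dt` on `ℝ²`. -/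
def bilinearTrace (g h : ℝ × Plane → ℂ) (x : Plane) : ℂ :=
  ∫ t in (0 : ℝ)..1, partialT g (t, x) * h (t, x)

end SharpTrace

end

noncomputable section

namespace SharpTrace

/-! ### Fourier transform: Plancherel, products and derivatives. -/

section Fourier
variable {V : Type*} [NormedAddCommGroup V] [InnerProductSpace ℝ V] [FiniteDimensional ℝ V]
  [MeasurableSpace V] [BorelSpace V]

/-! After a Fourier transform in space, the trace at frequency `ξ` is the integral over `η` of `∫₀¹
∂_t ĝ(t, ξ - η) ĥ(t, η) dt`. Fix two frequencies `ζ`, `η`, put `α = 1 + |ζ|`, `β = 1 + |η|`, and let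
`E(G) = ∫ α²|G|² + |G'|²`, similarly `E(H)` with `β`. The heart is the one-dimensional bound `|∫ G'
H| ≤ 5 (E(G)/α)^{1/2} (E(H)/β)^{1/2}` (`norm_integral_deriv_mul_le`). Cauchy-Schwarz alone gives
`E(G)^{1/2} E(H)^{1/2} / β`, which is enough if `α ≤ β`. If `α ≥ β`, integration by parts moves the
derivative to `H` and gains `1/α` instead; the boundary terms obey the trace inequality `|G(0)|²,
|G(1)|² ≤ 2 E(G)/α`. So the time derivative and the time integral together cost each factor half a
derivative.

Consequently the transform of the trace is dominated by a convolution of two nonnegative functions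
whose norms in `L²((1 + |ξ|) dξ)` are bounded by the `H¹` norms (`enorm_fourier_bilinearTrace_le`,
`halfNormSq_majorant_le`). What remains is the planar product law `H^{1/2} · H^{1/2} ⊆ B^0_{2,1}`,
in a form that only sees absolute values of Fourier transforms (`tsum_conv_le`). For output
frequency of size `2^k` the larger input frequency is at least about `2^k`. The other one is either
at most of that size, where a weighted Cauchy-Schwarz inequality applies, or larger, where a uniform
bound times the area of the annulus suffices. Each dyadic piece is thus a sum of terms `(x_k
y_k)^{1/2}` with `x_k`, `y_k` both summable in `k`, and Cauchy-Schwarz in `k` yields the `ℓ¹` sum.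

All manipulations are made for `g`, `h` of compact support in space; cutoffs with bounded gradients
and dominated convergence give the general case. -/

theorem continuous_fourier_of_integrable {f : V → ℂ} (hf : Integrable f) : Continuous (𝓕 f) :=
  VectorFourier.fourierIntegral_continuous Real.continuous_fourierChar
    (L := innerₗ V) continuous_inner hf

theorem norm_fourier_le_integral_norm (f : V → ℂ) (ξ : V) : ‖𝓕 f ξ‖ ≤ ∫ x, ‖f x‖ :=
  VectorFourier.norm_fourierIntegral_le_integral_norm _ _ _ _ _

theorem integral_mul_fourierInv_eq {f g : V → ℂ} (hf : Integrable f) (hg : Integrable g) :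
    ∫ x, f x * 𝓕⁻ g x = ∫ x, 𝓕⁻ f x * g x := by
  have h := VectorFourier.integral_fourierIntegral_smul_eq_flip (μ := (volume : Measure V))
    (ν := (volume : Measure V)) (L := innerₗ V) Real.continuous_fourierChar continuous_inner hf
    (hg.comp_neg)
  rw [flip_innerₗ] at h
  rw [Real.fourierInv_eq_fourier_comp_neg g]
  refine Eq.trans h.symm ?_
  rw [← integral_neg_eq_self]
  refine integral_congr_ae (.of_forall fun x => ?_)
  simp only [neg_neg, smul_eq_mul]
  rw [Real.fourierInv_eq_fourier_neg]
  rfl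

open SchwartzMap in
-- Both sides have the same integral against every smooth compactly supported function: the `L²`
-- transform agrees with the distributional one, and for the integral transform the duality
-- `integral_mul_fourierInv_eq` moves it onto the test function.
theorem fourierInv_toLp_ae_eq {F : V → ℂ} (h1 : Integrable F) (h2 : MemLp F 2) :
    ((𝓕⁻ h2.toLp : Lp ℂ 2 (volume : Measure V)) : V → ℂ) =ᵐ[volume] 𝓕⁻ F := by
  have hcont : Continuous (𝓕⁻ F) := by
    have : 𝓕⁻ F = fun w => 𝓕 F (-w) := by ext w; exact Real.fourierInv_eq_fourier_neg F w
    rw [this]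
    exact (continuous_fourier_of_integrable h1).comp continuous_neg
  refine ae_eq_of_integral_contDiff_smul_eq (Lp.memLp _ |>.locallyIntegrable (by norm_num))
    hcont.locallyIntegrable ?_
  intro g hg hgs
  have hg1 : HasCompactSupport (Complex.ofRealCLM ∘ g) := hgs.comp_left rfl
  have hg2 : ContDiff ℝ ∞ (Complex.ofRealCLM ∘ g) := by fun_prop
  set φ : 𝓢(V, ℂ) := hg1.toSchwartzMap hg2 with hφ
  have hφg : ∀ x, φ x = (g x : ℂ) := fun x => rfl
  have e1 := congrArg (fun T => T φ) (Lp.fourierInv_toTemperedDistribution_eq h2.toLp)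
  simp only [TemperedDistribution.fourierInv_apply, Lp.toTemperedDistribution_apply] at e1
  have e2 : ∀ x, g x • 𝓕⁻ F x = φ x * 𝓕⁻ F x := fun x => by
    rw [hφg, Complex.real_smul]
  have e3 : ∀ x, g x • (𝓕⁻ h2.toLp : Lp ℂ 2 (volume : Measure V)) x
      = φ x • (𝓕⁻ h2.toLp : Lp ℂ 2 (volume : Measure V)) x := fun x => by
    rw [hφg, Complex.real_smul, smul_eq_mul]
  simp only [e2, e3]
  rw [← e1, integral_mul_fourierInv_eq φ.integrable h1]
  refine integral_congr_ae ?_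
  filter_upwards [h2.coeFn_toLp] with x hx
  rw [hx, fourierInv_coe, smul_eq_mul]

/-- Plancherel's theorem for the inverse Fourier integral on `L¹ ∩ L²`. -/
theorem eLpNorm_fourierInv {F : V → ℂ} (h1 : Integrable F) (h2 : MemLp F 2) :
    eLpNorm (𝓕⁻ F) 2 volume = eLpNorm F 2 volume := by
  rw [← eLpNorm_congr_ae (fourierInv_toLp_ae_eq h1 h2), ← eLpNorm_congr_ae h2.coeFn_toLp,
    ← Lp.enorm_def, ← Lp.enorm_def, ← ofReal_norm, ← ofReal_norm]
  congr 1
  exact (Lp.fourierTransformₗᵢ V ℂ).symm.norm_map _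

open SchwartzMap in
-- Convolution of Schwartz functions is defined as the inverse transform of the product of the
-- transforms. Applied to `𝓕 v` and `𝓕 u`, it meets double transforms, which are reflections and
-- cancel.
theorem fourier_mul_eq_integral (u v : 𝓢(V, ℂ)) (ξ : V) :
    𝓕 (fun x => u x * v x) ξ = ∫ η, 𝓕 (u : V → ℂ) (ξ - η) * 𝓕 (v : V → ℂ) η := by
  have h := SchwartzMap.convolution_apply (ContinuousLinearMap.mul ℂ ℂ) (𝓕 v) (𝓕 u) ξ
  have e : SchwartzMap.convolution (ContinuousLinearMap.mul ℂ ℂ) (𝓕 v) (𝓕 u)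
      = 𝓕⁻ (pairing (ContinuousLinearMap.mul ℂ ℂ) (𝓕 (𝓕 v)) (𝓕 (𝓕 u))) := rfl
  have key : ∀ (w : 𝓢(V, ℂ)) (x : V), 𝓕 (𝓕 w) (-x) = w x := fun w x => by
    rw [fourier_coe, ← Real.fourierInv_eq_fourier_neg, ← fourierInv_coe,
      FourierTransform.fourierInv_fourier_eq]
  rw [e, fourierInv_coe, Real.fourierInv_eq_fourier_comp_neg] at h
  simp only [pairing_apply_apply, key, ContinuousLinearMap.mul_apply', convolution_def] at h
  simp only [mul_comm (u _), h, fourier_coe, mul_comm (𝓕 (u : V → ℂ) _)]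

open SchwartzMap in
theorem lintegral_enorm_sq_fourier (u : 𝓢(V, ℂ)) :
    ∫⁻ ξ, ‖𝓕 (u : V → ℂ) ξ‖ₑ ^ 2 = ∫⁻ x, ‖u x‖ₑ ^ 2 := by
  have h := u.integral_norm_sq_fourier
  have key : ∀ w : 𝓢(V, ℂ), ∫⁻ x, ‖w x‖ₑ ^ 2 = ENNReal.ofReal (∫ x, ‖w x‖ ^ 2) := fun w => by
    rw [ofReal_integral_eq_lintegral_ofReal _ (.of_forall fun x => by positivity)]
    · refine lintegral_congr fun x => ?_
      rw [ENNReal.ofReal_pow (norm_nonneg _), ofReal_norm]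
    · exact (memLp_two_iff_integrable_sq_norm w.continuous.aestronglyMeasurable).1 (w.memLp 2)
  rw [← fourier_coe, key, key, h]

open SchwartzMap in
theorem fourier_fderiv_apply (u : 𝓢(V, ℂ)) (m ξ : V) :
    𝓕 (fun x => fderiv ℝ u x m) ξ = 2 * Real.pi * Complex.I * (inner ℝ ξ m : ℝ) * 𝓕 (u : V → ℂ) ξ := by
  have h := congrArg (fun w : 𝓢(V, ℂ) => w ξ) (u.fourier_lineDerivOp_eq m)
  have hg : (fun x : V => inner ℝ x m).HasTemperateGrowth := ((innerSL ℝ).flip m).hasTemperateGrowth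
  simp only [fourier_coe] at h
  simp only [smul_apply, smulLeftCLM_apply_apply hg, fourier_coe] at h
  rw [show (fun x => fderiv ℝ u x m) = (LineDeriv.lineDerivOp m u : 𝓢(V, ℂ)) from rfl, h]
  simp [mul_assoc]

end Fourier
-- The bilinear estimate in time at fixed frequencies.
section OneDim

theorem intervalIntegral_mul_le_sqrt {a b : ℝ → ℝ} (ha : ContinuousOn a (Icc 0 1))
    (hb : ContinuousOn b (Icc 0 1)) :
    ∫ t in (0 : ℝ)..1, a t * b t ≤
      √(∫ t in (0 : ℝ)..1, a t ^ 2) * √(∫ t in (0 : ℝ)..1, b t ^ 2) := by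
  have hu : uIcc (0 : ℝ) 1 = Icc 0 1 := uIcc_of_le zero_le_one
  have ia : IntervalIntegrable (fun t => a t ^ 2) volume 0 1 :=
    ContinuousOn.intervalIntegrable (by rw [hu]; fun_prop)
  have ib : IntervalIntegrable (fun t => b t ^ 2) volume 0 1 :=
    ContinuousOn.intervalIntegrable (by rw [hu]; fun_prop)
  have iab : IntervalIntegrable (fun t => a t * b t) volume 0 1 :=
    ContinuousOn.intervalIntegrable (by rw [hu]; fun_prop)
  -- Cauchy-Schwarz through the discriminant of the nonnegative quadratic `x ↦ ∫ (x a - b)²`.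
  have hq : ∀ x : ℝ, 0 ≤ (∫ t in (0 : ℝ)..1, a t ^ 2) * (x * x)
      + (-2 * ∫ t in (0 : ℝ)..1, a t * b t) * x + ∫ t in (0 : ℝ)..1, b t ^ 2 := fun x => by
    have : ∫ t in (0 : ℝ)..1, (x * a t - b t) ^ 2 = (∫ t in (0 : ℝ)..1, a t ^ 2) * (x * x)
      + (-2 * ∫ t in (0 : ℝ)..1, a t * b t) * x + ∫ t in (0 : ℝ)..1, b t ^ 2 := by
      rw [show (fun t => (x * a t - b t) ^ 2)
        = fun t => (x * x) * a t ^ 2 + (-2 * x) * (a t * b t) + b t ^ 2 by ext; ring,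
        intervalIntegral.integral_add ((ia.const_mul _).add (iab.const_mul _)) ib,
        intervalIntegral.integral_add (ia.const_mul _) (iab.const_mul _),
        intervalIntegral.integral_const_mul, intervalIntegral.integral_const_mul]
      ring
    rw [← this]
    exact intervalIntegral.integral_nonneg zero_le_one fun t _ => by positivity
  have hd := discrim_le_zero hq
  rw [discrim] at hd
  rw [← Real.sqrt_mul (intervalIntegral.integral_nonneg zero_le_one fun t _ => by positivity)]
  exact Real.le_sqrt_of_sq_le (by linarith)

/-- The energy `∫₀¹ α² |G|² + |G'|²` of a curve. -/
def energy (α : ℝ) (G G' : ℝ → ℂ) : ℝ := ∫ t in (0 : ℝ)..1, (α ^ 2 * ‖G t‖ ^ 2 + ‖G' t‖ ^ 2)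

variable {G G' H H' : ℝ → ℂ} {α β : ℝ}

theorem energy_nonneg : 0 ≤ energy α G G' :=
  intervalIntegral.integral_nonneg zero_le_one fun t _ => by positivity

theorem sqrt_integral_norm_sq_le (hα : 1 ≤ α) (hG : ContinuousOn G (Icc 0 1))
    (hG' : ContinuousOn G' (Icc 0 1)) :
    √(∫ t in (0 : ℝ)..1, ‖G t‖ ^ 2) ≤ √(energy α G G') / α := by
  have hu : uIcc (0 : ℝ) 1 = Icc 0 1 := uIcc_of_le zero_le_one
  rw [le_div_iff₀ (by linarith), mul_comm]
  nth_rw 1 [← Real.sqrt_sq (by linarith : 0 ≤ α)]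
  rw [← Real.sqrt_mul (sq_nonneg _), energy, ← intervalIntegral.integral_const_mul]
  refine Real.sqrt_le_sqrt (intervalIntegral.integral_mono_on zero_le_one ?_ ?_ fun t _ => ?_)
  · exact ContinuousOn.intervalIntegrable (by rw [hu]; fun_prop)
  · exact ContinuousOn.intervalIntegrable (by rw [hu]; fun_prop)
  · exact le_add_of_nonneg_right (by positivity)

theorem sqrt_integral_norm_deriv_sq_le (hG : ContinuousOn G (Icc 0 1))
    (hG' : ContinuousOn G' (Icc 0 1)) :
    √(∫ t in (0 : ℝ)..1, ‖G' t‖ ^ 2) ≤ √(energy α G G') := by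
  have hu : uIcc (0 : ℝ) 1 = Icc 0 1 := uIcc_of_le zero_le_one
  refine Real.sqrt_le_sqrt (intervalIntegral.integral_mono_on zero_le_one ?_ ?_ fun t _ => ?_)
  · exact ContinuousOn.intervalIntegrable (by rw [hu]; fun_prop)
  · exact ContinuousOn.intervalIntegrable (by rw [hu]; fun_prop)
  · exact le_add_of_nonneg_left (by positivity)

/-- A trace inequality, from integrating the derivative of `(t - c) G(t)²`. The choice `c = 0`
isolates `G 1`, and `c = 1` isolates `G 0`. -/
theorem norm_endpoint_sq_le (hα : 1 ≤ α) (hG : ContinuousOn G (Icc 0 1))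
    (hG' : ContinuousOn G' (Icc 0 1)) (hd : ∀ t ∈ Ioo (0 : ℝ) 1, HasDerivAt G (G' t) t)
    {c : ℝ} (hc : c ∈ Icc (0 : ℝ) 1) :
    ‖(1 - c : ℂ) * G 1 ^ 2 + c * G 0 ^ 2‖ ≤ 2 * energy α G G' / α := by
  have hu : uIcc (0 : ℝ) 1 = Icc 0 1 := uIcc_of_le zero_le_one
  have hα0 : 0 < α := by linarith
  have hcont : ContinuousOn (fun t : ℝ => G t ^ 2 + (t - c : ℂ) * (2 * G t * G' t)) (Icc 0 1) := by
    fun_prop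
  have h := intervalIntegral.integral_eq_sub_of_hasDerivAt_of_le (a := 0) (b := 1) zero_le_one
    (f := fun t : ℝ => (t - c : ℂ) * G t ^ 2)
    (f' := fun t : ℝ => G t ^ 2 + (t - c : ℂ) * (2 * G t * G' t)) (by fun_prop) (fun t ht => by
      have h1 : HasDerivAt (fun t : ℝ => (t - c : ℂ)) 1 t :=
        (Complex.ofRealCLM.hasDerivAt (x := t)).sub_const _
      convert! h1.mul ((hd t ht).pow 2) using 1
      simp)
    (ContinuousOn.intervalIntegrable (by rwa [hu]))
  have e : (1 - c : ℂ) * G 1 ^ 2 + c * G 0 ^ 2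
    = ((1 : ℝ) - c : ℂ) * G 1 ^ 2 - ((0 : ℝ) - c : ℂ) * G 0 ^ 2 := by push_cast; ring
  rw [e, ← h]
  refine (intervalIntegral.norm_integral_le_integral_norm zero_le_one).trans ?_
  rw [mul_comm 2, mul_div_assoc, mul_comm, energy, ← intervalIntegral.integral_const_mul]
  refine intervalIntegral.integral_mono_on zero_le_one ?_ ?_ fun t ht => ?_
  · exact ContinuousOn.intervalIntegrable (by rw [hu]; fun_prop)
  · exact ContinuousOn.intervalIntegrable (by rw [hu]; fun_prop)
  · have hct : ‖(t - c : ℂ)‖ ≤ 1 := by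
      rw [← Complex.ofReal_sub, Complex.norm_real, Real.norm_eq_abs, abs_le]
      exact ⟨by linarith [ht.1, hc.2], by linarith [ht.2, hc.1]⟩
    have h1 : ‖G t ^ 2 + (t - c : ℂ) * (2 * G t * G' t)‖ ≤ ‖G t‖ ^ 2 + 2 * ‖G t‖ * ‖G' t‖ := by
      refine (norm_add_le _ _).trans ?_
      rw [norm_pow, norm_mul, norm_mul, norm_mul, Complex.norm_two]
      have := mul_le_mul_of_nonneg_right hct (by positivity : 0 ≤ 2 * ‖G t‖ * ‖G' t‖)
      linarith
    refine h1.trans ?_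
    rw [div_mul_eq_mul_div, le_div_iff₀ hα0]
    -- This combines `2α|G||G'| ≤ α²|G|² + |G'|²` with `α|G|² ≤ α²|G|²`, the latter because `α ≥ 1`.
    nlinarith [sq_nonneg (α * ‖G t‖ - ‖G' t‖), sq_nonneg (‖G t‖), sq_nonneg (‖G' t‖),
      mul_nonneg (mul_nonneg hα0.le (sub_nonneg.2 hα)) (sq_nonneg ‖G t‖)]

/-- The one-dimensional bilinear estimate: for `α ≤ β` it is the Cauchy-Schwarz inequality, and
otherwise one integrates by parts first. -/
theorem norm_integral_deriv_mul_le (hα : 1 ≤ α) (hβ : 1 ≤ β)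
    (hG : ContinuousOn G (Icc 0 1)) (hG' : ContinuousOn G' (Icc 0 1))
    (hdG : ∀ t ∈ Ioo (0 : ℝ) 1, HasDerivAt G (G' t) t)
    (hH : ContinuousOn H (Icc 0 1)) (hH' : ContinuousOn H' (Icc 0 1))
    (hdH : ∀ t ∈ Ioo (0 : ℝ) 1, HasDerivAt H (H' t) t) :
    ‖∫ t in (0 : ℝ)..1, G' t * H t‖ ≤ 5 * (√(energy α G G' / α) * √(energy β H H' / β)) := by
  have hu : uIcc (0 : ℝ) 1 = Icc 0 1 := uIcc_of_le zero_le_one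
  have hα0 : 0 < α := by linarith
  have hβ0 : 0 < β := by linarith
  have cs : ∀ {A B : ℝ → ℂ}, ContinuousOn A (Icc 0 1) → ContinuousOn B (Icc 0 1) →
      ‖∫ t in (0 : ℝ)..1, A t * B t‖ ≤
        √(∫ t in (0 : ℝ)..1, ‖A t‖ ^ 2) * √(∫ t in (0 : ℝ)..1, ‖B t‖ ^ 2) := fun hA hB => by
    refine (intervalIntegral.norm_integral_le_integral_norm zero_le_one).trans ?_
    simp only [norm_mul]
    exact intervalIntegral_mul_le_sqrt hA.norm hB.norm
  set P := √(energy α G G') with hP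
  set Q := √(energy β H H') with hQ
  have hP0 : 0 ≤ P := Real.sqrt_nonneg _
  have hQ0 : 0 ≤ Q := Real.sqrt_nonneg _
  have hrhs : √(energy α G G' / α) * √(energy β H H' / β) = P * Q / (√α * √β) := by
    rw [Real.sqrt_div energy_nonneg, Real.sqrt_div energy_nonneg, div_mul_div_comm]
  rw [hrhs]
  have hsα : 0 < √α := Real.sqrt_pos.2 hα0
  have hsβ : 0 < √β := Real.sqrt_pos.2 hβ0
  have hss : 0 < √α * √β := mul_pos hsα hsβ
  have hPQ : 0 ≤ P * Q := mul_nonneg hP0 hQ0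
  rcases le_total α β with hab | hab
  · have h1 : P * (Q / β) ≤ P * Q / (√α * √β) := by
      rw [← mul_div_assoc]
      refine div_le_div_of_nonneg_left hPQ hss ?_
      calc √α * √β ≤ √β * √β := by gcongr
        _ = β := Real.mul_self_sqrt hβ0.le
    have h2 : ‖∫ t in (0 : ℝ)..1, G' t * H t‖ ≤ P * (Q / β) :=
      (cs hG' hH).trans (mul_le_mul (sqrt_integral_norm_deriv_sq_le hG hG')
        (sqrt_integral_norm_sq_le hβ hH hH') (Real.sqrt_nonneg _) hP0)
    have := div_nonneg hPQ hss.le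
    linarith
  · have hparts := intervalIntegral.integral_deriv_mul_eq_sub_of_hasDeriv_right (a := 0) (b := 1)
      (u := G) (v := H) (u' := G') (v' := H') (by rwa [hu]) (by rwa [hu])
      (fun t ht => (hdG t (by simpa using ht)).hasDerivWithinAt)
      (fun t ht => (hdH t (by simpa using ht)).hasDerivWithinAt)
      (ContinuousOn.intervalIntegrable (by rwa [hu])) (ContinuousOn.intervalIntegrable (by rwa [hu]))
    rw [intervalIntegral.integral_add (ContinuousOn.intervalIntegrable (by rw [hu]; fun_prop))
      (ContinuousOn.intervalIntegrable (by rw [hu]; fun_prop))] at hparts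
    have hend : ∀ {γ : ℝ} {K K' : ℝ → ℂ}, 1 ≤ γ → ContinuousOn K (Icc 0 1) →
        ContinuousOn K' (Icc 0 1) → (∀ t ∈ Ioo (0 : ℝ) 1, HasDerivAt K (K' t) t) →
        ‖K 1‖ ≤ √2 * √(energy γ K K') / √γ ∧ ‖K 0‖ ≤ √2 * √(energy γ K K') / √γ :=
      fun hγ hK hK' hdK => by
        have h1 := norm_endpoint_sq_le hγ hK hK' hdK (c := 0) (by simp)
        have h0 := norm_endpoint_sq_le hγ hK hK' hdK (c := 1) (by simp)
        simp only [Complex.ofReal_zero, sub_zero, one_mul, zero_mul, add_zero, norm_pow,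
          Complex.ofReal_one, sub_self, zero_add] at h1 h0
        rw [← Real.sqrt_mul zero_le_two, ← Real.sqrt_div (mul_nonneg zero_le_two energy_nonneg)]
        exact ⟨Real.le_sqrt_of_sq_le h1, Real.le_sqrt_of_sq_le h0⟩
    obtain ⟨g1, g0⟩ := hend hα hG hG' hdG
    obtain ⟨k1, k0⟩ := hend hβ hH hH' hdH
    have hb : ∀ x y : ℂ, ‖x‖ ≤ √2 * P / √α → ‖y‖ ≤ √2 * Q / √β →
        ‖x * y‖ ≤ 2 * (P * Q / (√α * √β)) := fun x y hx hy => by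
      rw [norm_mul]
      refine (mul_le_mul hx hy (norm_nonneg _) (by positivity)).trans (le_of_eq ?_)
      rw [div_mul_div_comm, mul_mul_mul_comm, Real.mul_self_sqrt zero_le_two, mul_div_assoc]
    have h1 : (P / α) * Q ≤ P * Q / (√α * √β) := by
      rw [div_mul_eq_mul_div]
      refine div_le_div_of_nonneg_left hPQ hss ?_
      calc √α * √β ≤ √α * √α := by gcongr
        _ = α := Real.mul_self_sqrt hα0.le
    have h2 : ‖∫ t in (0 : ℝ)..1, G t * H' t‖ ≤ (P / α) * Q :=
      (cs hG hH').trans (mul_le_mul (sqrt_integral_norm_sq_le hα hG hG')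
        (sqrt_integral_norm_deriv_sq_le hH hH') (Real.sqrt_nonneg _) (by positivity))
    have h3 : ∫ t in (0 : ℝ)..1, G' t * H t
        = G 1 * H 1 - G 0 * H 0 - ∫ t in (0 : ℝ)..1, G t * H' t := by rw [← hparts]; ring
    -- The constant is `5 = 2 + 2 + 1`: two for each endpoint and one for the integral of `G H'`.
    rw [h3]
    have := norm_sub_le (G 1 * H 1 - G 0 * H 0) (∫ t in (0 : ℝ)..1, G t * H' t)
    have := norm_sub_le (G 1 * H 1) (G 0 * H 0)
    have := hb _ _ g1 k1
    have := hb _ _ g0 k0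
    linarith

end OneDim
-- Cauchy-Schwarz inequalities, dyadic sums and the radial weight.
section Bilinear

theorem sq_lintegral_mul_le {α : Type*} [MeasurableSpace α] {μ : Measure α} {f g : α → ℝ≥0∞}
    (hf : AEMeasurable f μ) (hg : AEMeasurable g μ) :
    (∫⁻ x, f x * g x ∂μ) ^ 2 ≤ (∫⁻ x, f x ^ 2 ∂μ) * ∫⁻ x, g x ^ 2 ∂μ := by
  have h := ENNReal.lintegral_mul_le_Lp_mul_Lq μ (p := 2) (q := 2)
    (by constructor <;> norm_num) hf hg
  have e : ∀ x : ℝ≥0∞, (x ^ (1 / 2 : ℝ)) ^ 2 = x := fun x => by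
    rw [← ENNReal.rpow_natCast, ← ENNReal.rpow_mul]; norm_num
  have h2 := pow_le_pow_left₀ zero_le h 2
  simpa only [mul_pow, e, ENNReal.rpow_two, Pi.mul_apply] using h2

theorem tsum_rpow_half_mul_le (x y : ℕ → ℝ≥0∞) :
    ∑' k, (x k * y k) ^ (1 / 2 : ℝ) ≤ (∑' k, x k) ^ (1 / 2 : ℝ) * (∑' k, y k) ^ (1 / 2 : ℝ) := by
  have h := ENNReal.lintegral_mul_le_Lp_mul_Lq (Measure.count : Measure ℕ) (p := 2) (q := 2)
    (f := fun k => x k ^ (1 / 2 : ℝ)) (g := fun k => y k ^ (1 / 2 : ℝ))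
    (by constructor <;> norm_num) (measurable_of_countable _).aemeasurable
    (measurable_of_countable _).aemeasurable
  have e : ∀ x : ℝ≥0∞, (x ^ (1 / 2 : ℝ)) ^ (2 : ℝ) = x := fun x => by
    rw [← ENNReal.rpow_mul]; norm_num
  simp only [lintegral_count, e, Pi.mul_apply] at h
  simpa only [ENNReal.mul_rpow_of_nonneg _ _ (by norm_num : (0 : ℝ) ≤ 1 / 2)] using h

theorem tsum_ofReal_le {a : ℕ → ℝ} {B : ℝ} (ha : ∀ k, 0 ≤ a k)
    (h : ∀ n, ∑ k ∈ Finset.range n, a k ≤ B) : ∑' k, ENNReal.ofReal (a k) ≤ ENNReal.ofReal B := by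
  refine ENNReal.tsum_le_of_sum_range_le fun n => ?_
  rw [← ENNReal.ofReal_sum_of_nonneg fun k _ => ha k]
  exact ENNReal.ofReal_le_ofReal (h n)

theorem sum_pow_two_indicator_le {r : ℝ} (hr : 0 ≤ r) (n : ℕ) :
    ∑ k ∈ Finset.range n, (if (2 : ℝ) ^ k ≤ r then (2 : ℝ) ^ k else 0) ≤ 2 * r := by
  induction n with
  | zero => simpa using hr
  | succ n ih =>
    rw [Finset.sum_range_succ]
    split_ifs with h
    · have h1 : ∑ k ∈ Finset.range n, (if (2 : ℝ) ^ k ≤ r then (2 : ℝ) ^ k else 0)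
          ≤ ∑ k ∈ Finset.range n, (2 : ℝ) ^ k := by
        refine Finset.sum_le_sum fun k _ => ?_
        split_ifs
        · exact le_rfl
        · positivity
      rw [geom_sum_eq (by norm_num)] at h1
      linarith
    · simpa using ih

theorem sum_inv_sqrt_indicator_le {s : ℝ} (hs : 0 < s) (n : ℕ) :
    ∑ k ∈ Finset.range n, (if s ≤ 5 * (2 : ℝ) ^ k then (√2)⁻¹ ^ k else 0) ≤ 10 / √s := by
  set q := (√2)⁻¹ with hq
  have hq0 : 0 < q := by positivity
  have hq1 : q ≤ 3 / 4 := by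
    rw [hq]
    refine inv_le_of_inv_le₀ (by norm_num) (Real.le_sqrt_of_sq_le (by norm_num))
  -- The bound is strengthened so that induction closes: since `q ≤ 3/4`, the term `q^n` is at most
  -- `4 (q^n - q^{n+1})`, and it occurs only when `q^n ≤ √5/√s`.
  have key : ∑ k ∈ Finset.range n, (if s ≤ 5 * (2 : ℝ) ^ k then q ^ k else 0)
      ≤ 4 * max (√5 / √s - q ^ n) 0 := by
    induction n with
    | zero => simp
    | succ n ih =>
      rw [Finset.sum_range_succ]
      have hqn : 0 < q ^ n := by positivity
      have hqs : q ^ (n + 1) ≤ 3 / 4 * q ^ n := by rw [pow_succ']; gcongr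
      split_ifs with h
      · have h1 : q ^ n ≤ √5 / √s := by
          rw [le_div_iff₀ (by positivity), hq, inv_pow, inv_mul_le_iff₀ (by positivity)]
          have : (√2) ^ n = √(2 ^ n) := by
            rw [← Real.sqrt_sq (by positivity : 0 ≤ √2 ^ n), ← pow_mul, mul_comm, pow_mul,
              Real.sq_sqrt zero_le_two]
          rw [this, ← Real.sqrt_mul (by positivity)]
          exact Real.sqrt_le_sqrt (by linarith)
        rw [max_eq_left (by linarith)] at ih
        have := le_max_left (√5 / √s - q ^ (n + 1)) 0
        linarith
      · rw [add_zero]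
        refine ih.trans (mul_le_mul_of_nonneg_left (max_le_max ?_ le_rfl) (by norm_num))
        linarith
  refine key.trans ?_
  have h5 : √5 ≤ 5 / 2 := Real.sqrt_le_iff.2 ⟨by norm_num, by norm_num⟩
  have : max (√5 / √s - q ^ n) 0 ≤ (5 / 2) / √s := by
    refine max_le ?_ (by positivity)
    have : √5 / √s ≤ (5 / 2) / √s := by gcongr
    have : 0 < q ^ n := by positivity
    linarith
  calc 4 * max (√5 / √s - q ^ n) 0 ≤ 4 * ((5 / 2) / √s) := by gcongr
    _ = 10 / √s := by ring

/-- The weight `(1 + |ζ|)^{3/2}`. -/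
def wt (ζ : Plane) : ℝ := (1 + ‖ζ‖) * √(1 + ‖ζ‖)

theorem wt_pos (ζ : Plane) : 0 < wt ζ := by unfold wt; positivity

@[fun_prop]
theorem continuous_wt : Continuous wt := by unfold wt; fun_prop

/-- In polar coordinates the integrand is `r (1 + r)^{-3/2} ≤ (1 + r)^{-1/2}`, with primitive `2 √(1
+ r)`. The exponent `3/2` lies strictly between `1` and `2`: below `2` the integral grows like a
positive power of `R`, and above `1` the dyadic sum in `tsum_ball_le` converges. -/
theorem lintegral_inv_wt_le : ∃ C : ℝ≥0, ∀ R : ℝ, 0 ≤ R →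
    ∫⁻ ζ in Metric.closedBall (0 : Plane) R, ENNReal.ofReal (wt ζ)⁻¹ ≤ C * ENNReal.ofReal √(1 + R) := by
  refine ⟨(4 * (volume : Measure Plane).real (Metric.ball 0 1)).toNNReal, fun R hR => ?_⟩
  have hcont : Continuous fun r : ℝ => r * ((1 + |r|) * √(1 + |r|))⁻¹ := by
    refine continuous_id.mul (Continuous.inv₀ (by fun_prop) fun r => ?_)
    positivity
  have hpol := integral_fun_norm_addHaar (volume : Measure Plane)
    ((Iic R).indicator fun r : ℝ => ((1 + |r|) * √(1 + |r|))⁻¹)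
  have hl : ∀ ζ : Plane, (Iic R).indicator (fun r : ℝ => ((1 + |r|) * √(1 + |r|))⁻¹) ‖ζ‖
      = (Metric.closedBall (0 : Plane) R).indicator (fun ζ => (wt ζ)⁻¹) ζ := fun ζ => by
    simp [indicator, wt]
  simp only [hl, finrank_euclideanSpace, Fintype.card_fin, Nat.add_one_sub_one, pow_one, smul_eq_mul,
    nsmul_eq_mul] at hpol
  rw [integral_indicator Metric.isClosed_closedBall.measurableSet] at hpol
  rw [← ofReal_integral_eq_lintegral_ofReal _ (.of_forall fun ζ => (inv_pos.2 (wt_pos ζ)).le), hpol]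
  swap
  · exact (ContinuousOn.inv₀ (by fun_prop) fun ζ _ => (wt_pos ζ).ne').integrableOn_compact
      (isCompact_closedBall _ _)
  have hr : ∫ y in Ioi (0 : ℝ), y * (Iic R).indicator (fun r : ℝ => ((1 + |r|) * √(1 + |r|))⁻¹) y
      ≤ 2 * √(1 + R) := by
    have e1 : ∀ y, y * (Iic R).indicator (fun r : ℝ => ((1 + |r|) * √(1 + |r|))⁻¹) y
        = (Iic R).indicator (fun r : ℝ => r * ((1 + |r|) * √(1 + |r|))⁻¹) y := fun y => by
      by_cases h : y ∈ Iic R <;> simp [h]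
    simp only [e1]
    rw [setIntegral_indicator measurableSet_Iic, Ioi_inter_Iic,
      ← intervalIntegral.integral_of_le hR]
    have hd : ∀ x ∈ Ioo 0 R, HasDerivAt (fun r : ℝ => 2 * √(1 + r)) ((√(1 + x))⁻¹) x := fun x hx => by
      have h1 : HasDerivAt (fun r : ℝ => 1 + r) 1 x := (hasDerivAt_id x).const_add 1
      have h2 := (h1.sqrt (by linarith [hx.1])).const_mul 2
      convert! h2 using 1
      field_simp
    have hc : ContinuousOn (fun x : ℝ => (√(1 + x))⁻¹) (uIcc 0 R) := by
      rw [uIcc_of_le hR]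
      refine ContinuousOn.inv₀ (by fun_prop) fun x hx => ?_
      have := hx.1
      positivity
    have hi := intervalIntegral.integral_eq_sub_of_hasDerivAt_of_le hR
      (f := fun r : ℝ => 2 * √(1 + r)) (by fun_prop) hd hc.intervalIntegrable
    have hmono := intervalIntegral.integral_mono_on (μ := volume) hR (hcont.intervalIntegrable 0 R)
      hc.intervalIntegrable (fun x hx => by
        have hx0 := hx.1
        rw [abs_of_nonneg hx0, mul_inv, ← mul_assoc]
        refine mul_le_of_le_one_left (by positivity) ?_
        rw [← div_eq_mul_inv, div_le_one (by positivity)]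
        linarith)
    refine hmono.trans ?_
    rw [hi]
    have : 0 ≤ √(1 + (0 : ℝ)) := Real.sqrt_nonneg _
    linarith
  have : (((4 * (volume : Measure Plane).real (Metric.ball 0 1) : ℝ)).toNNReal : ℝ≥0∞)
      * ENNReal.ofReal √(1 + R)
      = ENNReal.ofReal (4 * (volume : Measure Plane).real (Metric.ball 0 1) * √(1 + R)) := by
    rw [ENNReal.ofReal_mul (by positivity)]; rfl
  rw [this]
  refine ENNReal.ofReal_le_ofReal ?_
  have hm : 0 ≤ (volume : Measure Plane).real (Metric.ball 0 1) := measureReal_nonneg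
  push_cast
  nlinarith [mul_le_mul_of_nonneg_left hr hm]

end Bilinear
-- The product law for half a derivative in the plane.
section Bilinear

/-- The convolution of two nonnegative functions on the plane. -/
def conv (u v : Plane → ℝ≥0∞) (ξ : Plane) : ℝ≥0∞ := ∫⁻ η, u (ξ - η) * v η

/-- The square of the norm of `L²((1 + |ξ|) dξ)`. -/
def halfNormSq (u : Plane → ℝ≥0∞) : ℝ≥0∞ := ∫⁻ ξ, ENNReal.ofReal (1 + ‖ξ‖) * u ξ ^ 2

variable {u v : Plane → ℝ≥0∞}

theorem measurable_conv (hu : Measurable u) (hv : Measurable v) : Measurable (conv u v) :=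
  Measurable.lintegral_prod_right' (f := fun p : Plane × Plane => u (p.1 - p.2) * v p.2) (by fun_prop)

theorem conv_sq_le (hu : Measurable u) (hv : Measurable v) (ξ : Plane) :
    conv u v ξ ^ 2 ≤ (∫⁻ ζ, u ζ ^ 2) * ∫⁻ η, v η ^ 2 := by
  refine (sq_lintegral_mul_le (by fun_prop) (by fun_prop)).trans (le_of_eq ?_)
  rw [lintegral_sub_left_eq_self (fun ζ => u ζ ^ 2) ξ]

/-- On `S`, `u` is written as `wt^{-1/2}` times `wt^{1/2} u`. Cauchy-Schwarz keeps `v` with the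
second factor, and Tonelli separates the remaining double integral. -/
theorem lintegral_sq_conv_le {S : Set Plane} (hS : MeasurableSet S) (hu : Measurable u)
    (hv : Measurable v) :
    ∫⁻ ξ, conv (S.indicator u) v ξ ^ 2 ≤
      (∫⁻ ζ in S, ENNReal.ofReal (wt ζ)⁻¹) * ((∫⁻ ζ in S, ENNReal.ofReal (wt ζ) * u ζ ^ 2)
        * ∫⁻ η, v η ^ 2) := by
  set a : Plane → ℝ≥0∞ := fun ζ => S.indicator (fun ζ => ENNReal.ofReal (√(wt ζ))⁻¹) ζ with ha
  set b : Plane → ℝ≥0∞ := fun ζ => S.indicator (fun ζ => ENNReal.ofReal (√(wt ζ)) * u ζ) ζ with hb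
  have hma : Measurable a := Measurable.indicator (by fun_prop) hS
  have hmb : Measurable b := Measurable.indicator (by fun_prop) hS
  have hab : ∀ ζ, S.indicator u ζ = a ζ * b ζ := fun ζ => by
    by_cases h : ζ ∈ S
    · simp only [ha, hb, indicator_of_mem h]
      rw [← mul_assoc, ← ENNReal.ofReal_mul (by positivity),
        inv_mul_cancel₀ (Real.sqrt_pos.2 (wt_pos ζ)).ne', ENNReal.ofReal_one, one_mul]
    · simp [ha, hb, h]
  have ha2 : ∫⁻ ζ, a ζ ^ 2 = ∫⁻ ζ in S, ENNReal.ofReal (wt ζ)⁻¹ := by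
    rw [← lintegral_indicator hS]
    refine lintegral_congr fun ζ => ?_
    by_cases h : ζ ∈ S
    · simp only [ha, indicator_of_mem h]
      rw [← ENNReal.ofReal_pow (by positivity), inv_pow, Real.sq_sqrt (wt_pos ζ).le]
    · simp [ha, h]
  have hb2 : ∫⁻ ζ, b ζ ^ 2 = ∫⁻ ζ in S, ENNReal.ofReal (wt ζ) * u ζ ^ 2 := by
    rw [← lintegral_indicator hS]
    refine lintegral_congr fun ζ => ?_
    by_cases h : ζ ∈ S
    · simp only [hb, indicator_of_mem h]
      rw [mul_pow, ← ENNReal.ofReal_pow (by positivity), Real.sq_sqrt (wt_pos ζ).le]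
    · simp [hb, h]
  have h1 : ∀ ξ, conv (S.indicator u) v ξ ^ 2
      ≤ (∫⁻ ζ, a ζ ^ 2) * ∫⁻ η, b (ξ - η) ^ 2 * v η ^ 2 := fun ξ => by
    have := sq_lintegral_mul_le (μ := (volume : Measure Plane)) (f := fun η => a (ξ - η))
      (g := fun η => b (ξ - η) * v η) (by fun_prop) (by fun_prop)
    simp only [mul_pow] at this
    rw [lintegral_sub_left_eq_self (fun ζ => a ζ ^ 2) ξ] at this
    simpa only [conv, hab, mul_assoc] using this
  refine (lintegral_mono h1).trans ?_
  rw [lintegral_const_mul _ (Measurable.lintegral_prod_right'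
    (f := fun p : Plane × Plane => b (p.1 - p.2) ^ 2 * v p.2 ^ 2) (by fun_prop)),
    lintegral_lintegral_swap (by fun_prop), ha2, ← hb2]
  gcongr
  rw [← lintegral_const_mul _ (by fun_prop)]
  refine le_of_eq (lintegral_congr fun η => ?_)
  simp only
  rw [lintegral_mul_const _ (by fun_prop), lintegral_sub_right_eq_self (fun ζ => b ζ ^ 2) η]

/-- The part of the convolution where the second frequency is the larger one. -/
def lowHigh (u v : Plane → ℝ≥0∞) (ξ : Plane) : ℝ≥0∞ :=
  ∫⁻ η, {p : Plane × Plane | ‖p.1 - p.2‖ ≤ ‖p.2‖}.indicator (fun p => u (p.1 - p.2) * v p.2) (ξ, η)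

theorem measurableSet_lowHigh : MeasurableSet {p : Plane × Plane | ‖p.1 - p.2‖ ≤ ‖p.2‖} :=
  (isClosed_le (by fun_prop) (by fun_prop)).measurableSet

theorem measurable_lowHigh (hu : Measurable u) (hv : Measurable v) : Measurable (lowHigh u v) :=
  Measurable.lintegral_prod_right' (Measurable.indicator (by fun_prop) measurableSet_lowHigh)

/-- The substitution `η ↦ ξ - η` exchanges the two input frequencies, so the region where the first
one dominates is the other region with `u` and `v` swapped. -/
theorem conv_le_lowHigh_add (hu : Measurable u) (hv : Measurable v) (ξ : Plane) :
    conv u v ξ ≤ lowHigh u v ξ + lowHigh v u ξ := by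
  have h : lowHigh v u ξ = ∫⁻ η, {p : Plane × Plane | ‖p.1 - p.2‖ ≤ ‖p.2‖}.indicator
      (fun p => v (p.1 - p.2) * u p.2) (ξ, ξ - η) :=
    (lintegral_sub_left_eq_self (fun η => {p : Plane × Plane | ‖p.1 - p.2‖ ≤ ‖p.2‖}.indicator
      (fun p => v (p.1 - p.2) * u p.2) (ξ, η)) ξ).symm
  have hm : Measurable fun η => {p : Plane × Plane | ‖p.1 - p.2‖ ≤ ‖p.2‖}.indicator
      (fun p => u (p.1 - p.2) * v p.2) (ξ, η) :=
    Measurable.comp (Measurable.indicator (by fun_prop) measurableSet_lowHigh) measurable_prodMk_left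
  rw [h, lowHigh, ← lintegral_add_left hm]
  refine lintegral_mono fun η => ?_
  rcases le_total ‖ξ - η‖ ‖η‖ with h | h
  · rw [indicator_of_mem (by exact h)]
    exact le_self_add
  · have h' : (ξ, ξ - η) ∈ {p : Plane × Plane | ‖p.1 - p.2‖ ≤ ‖p.2‖} := by simpa using h
    rw [indicator_of_mem h']
    simp only [sub_sub_cancel]
    rw [mul_comm (v η)]
    exact le_add_self

/-- The annulus of frequencies of size about `2 ^ k`. -/
def annulus (k : ℕ) : Set Plane := {ξ | (2 : ℝ) ^ k ≤ 2 * ‖ξ‖ ∧ ‖ξ‖ ≤ 2 * 2 ^ k}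

/-- The frequencies of size at least about `2 ^ k`. -/
def highFreq (k : ℕ) : Set Plane := {ξ | (2 : ℝ) ^ k ≤ 4 * ‖ξ‖}

theorem measurableSet_highFreq (k : ℕ) : MeasurableSet (highFreq k) :=
  (isClosed_le (by fun_prop) (by fun_prop)).measurableSet

theorem measurableSet_annulus (k : ℕ) : MeasurableSet (annulus k) :=
  (measurableSet_le (f := fun _ : Plane => (2 : ℝ) ^ k) (g := fun ξ => 2 * ‖ξ‖)
    (by fun_prop) (by fun_prop)).inter
    (measurableSet_le (f := fun ξ : Plane => ‖ξ‖) (g := fun _ => 2 * 2 ^ k)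
      (by fun_prop) (by fun_prop))

/-- Since `|ξ| ≤ |ξ - η| + |η| ≤ 2|η|` and `|ξ| ≥ 2^k/2`, the larger frequency satisfies `|η| ≥
2^k/4`. The smaller one lies in the ball of radius `4 · 2^k` or else is itself high. -/
theorem lowHigh_le_add (hu : Measurable u) (hv : Measurable v) {k : ℕ} {ξ : Plane}
    (hξ : ξ ∈ annulus k) :
    lowHigh u v ξ ≤
      conv ((Metric.closedBall 0 (4 * 2 ^ k)).indicator u) ((highFreq k).indicator v) ξ
        + conv ((highFreq k).indicator u) ((highFreq k).indicator v) ξ := by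
  have m1 := hu.indicator (Metric.isClosed_closedBall (x := (0 : Plane)) (ε := 4 * 2 ^ k)).measurableSet
  have m2 := hu.indicator (measurableSet_highFreq k)
  have m3 := hv.indicator (measurableSet_highFreq k)
  rw [conv, conv, ← lintegral_add_left (by fun_prop)]
  refine lintegral_mono fun η => ?_
  by_cases h : ‖ξ - η‖ ≤ ‖η‖
  · have tri : ‖ξ‖ ≤ ‖ξ - η‖ + ‖η‖ := by simpa using norm_add_le (ξ - η) η
    have tri' : ‖η‖ ≤ ‖ξ - η‖ + ‖ξ‖ := by
      have := norm_sub_le ξ (ξ - η)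
      rw [sub_sub_cancel] at this
      linarith
    have hη : η ∈ highFreq k := by
      change (2 : ℝ) ^ k ≤ 4 * ‖η‖
      linarith [hξ.1]
    rw [indicator_of_mem (by exact h), indicator_of_mem hη]
    by_cases h4 : ‖ξ - η‖ ≤ 4 * 2 ^ k
    · rw [indicator_of_mem (s := Metric.closedBall 0 _) (by simpa using h4)]
      exact le_self_add
    · have hζ : ξ - η ∈ highFreq k := by
        change (2 : ℝ) ^ k ≤ 4 * ‖ξ - η‖
        have : (0 : ℝ) < 2 ^ k := by positivity
        linarith
      rw [indicator_of_mem hζ]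
      exact le_add_self
  · rw [indicator_of_notMem (by exact h)]
    exact zero_le

theorem lintegral_indicator_sq {S : Set Plane} (hS : MeasurableSet S) (w : Plane → ℝ≥0∞) :
    ∫⁻ ζ, S.indicator w ζ ^ 2 = ∫⁻ ζ in S, w ζ ^ 2 := by
  rw [← lintegral_indicator hS]
  refine lintegral_congr fun ζ => ?_
  by_cases h : ζ ∈ S <;> simp [h]

/-- Exchanging sum and integral reduces a weighted sum over `k` to a pointwise bound on the total
weight at each frequency. -/
theorem tsum_mul_setLIntegral_le {S : ℕ → Set Plane} (hS : ∀ k, MeasurableSet (S k)) (c : ℕ → ℝ)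
    {w f : Plane → ℝ≥0∞} (hw : Measurable w)
    (h : ∀ ζ, (∑' k, ENNReal.ofReal ((S k).indicator (fun _ => c k) ζ)) * w ζ ≤ f ζ) :
    ∑' k, ENNReal.ofReal (c k) * ∫⁻ ζ in S k, w ζ ≤ ∫⁻ ζ, f ζ := by
  have e : ∀ k, ENNReal.ofReal (c k) * ∫⁻ ζ in S k, w ζ
      = ∫⁻ ζ, ENNReal.ofReal ((S k).indicator (fun _ => c k) ζ) * w ζ := fun k => by
    rw [← lintegral_const_mul _ hw, ← lintegral_indicator (hS k)]
    refine lintegral_congr fun ζ => ?_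
    by_cases h : ζ ∈ S k <;> simp [h]
  simp only [e]
  have hm : ∀ k, Measurable fun ζ => ENNReal.ofReal ((S k).indicator (fun _ => c k) ζ) * w ζ :=
    fun k => (ENNReal.measurable_ofReal.comp (measurable_const.indicator (hS k))).mul hw
  rw [← lintegral_tsum fun k => (hm k).aemeasurable]
  refine lintegral_mono fun ζ => ?_
  rw [ENNReal.tsum_mul_right]
  exact h ζ

theorem tsum_highFreq_le (hu : Measurable u) :
    ∑' k : ℕ, ENNReal.ofReal (2 ^ k) * ∫⁻ ζ in highFreq k, u ζ ^ 2 ≤ 8 * halfNormSq u := by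
  rw [halfNormSq, ← lintegral_const_mul _ (by fun_prop)]
  refine tsum_mul_setLIntegral_le measurableSet_highFreq _ (by fun_prop) fun ζ => ?_
  rw [← mul_assoc, show (8 : ℝ≥0∞) = ENNReal.ofReal 8 by norm_num, ← ENNReal.ofReal_mul (by norm_num)]
  gcongr
  refine tsum_ofReal_le (fun k => indicator_nonneg (fun _ _ => by positivity) _) fun n => ?_
  have h := sum_pow_two_indicator_le (r := 4 * ‖ζ‖) (by positivity) n
  refine le_trans (le_of_eq (Finset.sum_congr rfl fun k _ => ?_)) (h.trans (by linarith))
  simp only [indicator, highFreq, mem_ofPred_eq]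
  congr

/-- At `ζ` only the `k` with `|ζ| ≤ 4 · 2^k` contribute, hence `1 + |ζ| ≤ 5 · 2^k`. The geometric
tail of `2^{-k/2}` is at most `10 (1 + |ζ|)^{-1/2}`, which lowers the weight from exponent `3/2` to
`1`. -/
theorem tsum_ball_le (hu : Measurable u) :
    ∑' k : ℕ, ENNReal.ofReal ((√2)⁻¹ ^ k) *
      ∫⁻ ζ in Metric.closedBall 0 (4 * 2 ^ k), ENNReal.ofReal (wt ζ) * u ζ ^ 2
      ≤ 10 * halfNormSq u := by
  rw [halfNormSq, ← lintegral_const_mul _ (by fun_prop)]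
  refine tsum_mul_setLIntegral_le (fun k => Metric.isClosed_closedBall.measurableSet) _
    (by fun_prop) fun ζ => ?_
  rw [← mul_assoc, ← mul_assoc, show (10 : ℝ≥0∞) = ENNReal.ofReal 10 by norm_num,
    ← ENNReal.ofReal_mul (by norm_num)]
  gcongr
  have hs : 0 < 1 + ‖ζ‖ := by positivity
  have h1 : ∑' k : ℕ, ENNReal.ofReal ((Metric.closedBall (0 : Plane) (4 * 2 ^ k)).indicator
      (fun _ => (√2)⁻¹ ^ k) ζ) ≤ ENNReal.ofReal (10 / √(1 + ‖ζ‖)) := by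
    refine tsum_ofReal_le (fun k => indicator_nonneg (fun _ _ => by positivity) _) fun n => ?_
    refine le_trans (Finset.sum_le_sum fun k _ => ?_) (sum_inv_sqrt_indicator_le hs n)
    have hk : (1 : ℝ) ≤ 2 ^ k := one_le_pow₀ one_le_two
    by_cases hm : ζ ∈ Metric.closedBall (0 : Plane) (4 * 2 ^ k)
    · have hm' : ‖ζ‖ ≤ 4 * 2 ^ k := by simpa using hm
      rw [indicator_of_mem hm, if_pos (by linarith)]
    · rw [indicator_of_notMem hm]
      split_ifs <;> positivity
  refine (mul_le_mul_left h1 _).trans ?_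
  rw [← ENNReal.ofReal_mul (by positivity), wt]
  refine ENNReal.ofReal_le_ofReal (le_of_eq ?_)
  have := Real.sqrt_pos.2 hs
  field_simp

theorem volume_annulus_le (k : ℕ) :
    volume (annulus k) ≤ 4 * volume (Metric.closedBall (0 : Plane) 1) * ENNReal.ofReal (2 ^ k * 2 ^ k) := by
  have h : annulus k ⊆ Metric.closedBall 0 (2 * 2 ^ k * 1) := fun ξ hξ => by simpa using hξ.2
  refine (measure_mono h).trans ?_
  rw [Measure.addHaar_closedBall_mul _ _ (by positivity) zero_le_one]
  simp only [finrank_euclideanSpace, Fintype.card_fin]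
  rw [show ((2 : ℝ) * 2 ^ k) ^ 2 = 4 * (2 ^ k * 2 ^ k) by ring,
    ENNReal.ofReal_mul (by norm_num), ENNReal.ofReal_ofNat]
  exact le_of_eq (by ring)

/-- The powers of two are distributed so that every factor is summable in `k`. The near part carries
`2^{k/2} = 2^{-k/2} · 2^k`; the far part carries the area `4^k` of the annulus, one `2^k` for each
function. -/
theorem setLIntegral_lowHigh_sq_le : ∃ C : ℝ≥0, ∀ u v : Plane → ℝ≥0∞, Measurable u → Measurable v →
    ∀ k : ℕ, ∫⁻ ξ in annulus k, lowHigh u v ξ ^ 2 ≤ C * (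
      ((ENNReal.ofReal ((√2)⁻¹ ^ k) *
        ∫⁻ ζ in Metric.closedBall 0 (4 * 2 ^ k), ENNReal.ofReal (wt ζ) * u ζ ^ 2) *
        (ENNReal.ofReal (2 ^ k) * ∫⁻ ζ in highFreq k, v ζ ^ 2)) +
      (ENNReal.ofReal (2 ^ k) * ∫⁻ ζ in highFreq k, u ζ ^ 2) *
        (ENNReal.ofReal (2 ^ k) * ∫⁻ ζ in highFreq k, v ζ ^ 2)) := by
  obtain ⟨C₀, hC₀⟩ := lintegral_inv_wt_le
  have hvol : volume (Metric.closedBall (0 : Plane) 1) ≠ ⊤ := (isCompact_closedBall _ _).measure_ne_top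
  obtain ⟨κ, hκ⟩ : ∃ κ : ℝ≥0, (κ : ℝ≥0∞) = volume (Metric.closedBall (0 : Plane) 1) :=
    ⟨_, ENNReal.coe_toNNReal hvol⟩
  refine ⟨2 * (3 * C₀ + 4 * κ), fun u v hu hv k => ?_⟩
  have hb := (Metric.isClosed_closedBall (x := (0 : Plane)) (ε := 4 * 2 ^ k)).measurableSet
  have m1 := hu.indicator hb
  have m2 := hu.indicator (measurableSet_highFreq k)
  have m3 := hv.indicator (measurableSet_highFreq k)
  set near := conv ((Metric.closedBall 0 (4 * 2 ^ k)).indicator u) ((highFreq k).indicator v)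
  set far := conv ((highFreq k).indicator u) ((highFreq k).indicator v)
  have mn : Measurable near := measurable_conv m1 m3
  set X := ∫⁻ ζ in Metric.closedBall 0 (4 * 2 ^ k), ENNReal.ofReal (wt ζ) * u ζ ^ 2
  set U := ∫⁻ ζ in highFreq k, u ζ ^ 2
  set W := ∫⁻ ζ in highFreq k, v ζ ^ 2
  have step : ∫⁻ ξ in annulus k, lowHigh u v ξ ^ 2
      ≤ 2 * ((∫⁻ ξ, near ξ ^ 2) + ∫⁻ ξ in annulus k, far ξ ^ 2) := by
    calc ∫⁻ ξ in annulus k, lowHigh u v ξ ^ 2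
        ≤ ∫⁻ ξ in annulus k, 2 * (near ξ ^ 2 + far ξ ^ 2) := by
          refine setLIntegral_mono' (measurableSet_annulus k) fun ξ hξ => ?_
          refine (pow_le_pow_left₀ zero_le (lowHigh_le_add hu hv hξ) 2).trans ?_
          have := ENNReal.rpow_add_le_mul_rpow_add_rpow (near ξ) (far ξ) one_le_two
          norm_num at this
          exact this
      _ = 2 * ((∫⁻ ξ in annulus k, near ξ ^ 2) + ∫⁻ ξ in annulus k, far ξ ^ 2) := by
          rw [lintegral_const_mul' _ _ (by norm_num), lintegral_add_left (by fun_prop)]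
      _ ≤ _ := by gcongr; exact Measure.restrict_le_self
  have hnear : ∫⁻ ξ, near ξ ^ 2
      ≤ 3 * C₀ * ((ENNReal.ofReal ((√2)⁻¹ ^ k) * X) * (ENNReal.ofReal (2 ^ k) * W)) := by
    refine (lintegral_sq_conv_le hb hu m3).trans ?_
    rw [lintegral_indicator_sq (measurableSet_highFreq k)]
    -- Here `1 + 4 · 2^k ≤ 9 · 2^k`, whence the factor `3` after the square root.
    have h1 : ENNReal.ofReal √(1 + 4 * 2 ^ k)
        ≤ 3 * (ENNReal.ofReal ((√2)⁻¹ ^ k) * ENNReal.ofReal (2 ^ k)) := by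
      rw [show (3 : ℝ≥0∞) = ENNReal.ofReal 3 by norm_num, ← ENNReal.ofReal_mul (by positivity),
        ← ENNReal.ofReal_mul (by norm_num)]
      refine ENNReal.ofReal_le_ofReal ?_
      have hk : (1 : ℝ) ≤ 2 ^ k := one_le_pow₀ one_le_two
      have e : (√2)⁻¹ ^ k * 2 ^ k = √(2 ^ k) := by
        have : (√2) ^ k * √2 ^ k = 2 ^ k := by rw [← mul_pow, Real.mul_self_sqrt zero_le_two]
        have h2 : √(2 ^ k) = (√2) ^ k := by
          rw [← this, Real.sqrt_mul_self (by positivity)]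
        rw [h2, ← this, inv_pow]
        field_simp
      rw [e]
      refine Real.sqrt_le_iff.2 ⟨by positivity, ?_⟩
      rw [mul_pow, Real.sq_sqrt (by positivity)]
      linarith
    calc _ ≤ (C₀ * (3 * (ENNReal.ofReal ((√2)⁻¹ ^ k) * ENNReal.ofReal (2 ^ k)))) * (X * W) := by
          gcongr
          exact (hC₀ _ (by positivity)).trans (by gcongr)
      _ = _ := by ring
  have hfar : ∫⁻ ξ in annulus k, far ξ ^ 2
      ≤ 4 * κ * ((ENNReal.ofReal (2 ^ k) * U) * (ENNReal.ofReal (2 ^ k) * W)) := by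
    have h1 : ∀ ξ, far ξ ^ 2 ≤ U * W := fun ξ => by
      refine (conv_sq_le m2 m3 ξ).trans (le_of_eq ?_)
      rw [lintegral_indicator_sq (measurableSet_highFreq k),
        lintegral_indicator_sq (measurableSet_highFreq k)]
    calc _ ≤ ∫⁻ ξ in annulus k, U * W := lintegral_mono h1
      _ = U * W * volume (annulus k) := setLIntegral_const _ _
      _ ≤ U * W * (4 * κ * ENNReal.ofReal (2 ^ k * 2 ^ k)) := by
          gcongr
          rw [hκ]
          exact volume_annulus_le k
      _ = _ := by rw [ENNReal.ofReal_mul (by positivity)]; ring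
  refine step.trans ?_
  set Y := (ENNReal.ofReal ((√2)⁻¹ ^ k) * X) * (ENNReal.ofReal (2 ^ k) * W)
  set Z := (ENNReal.ofReal (2 ^ k) * U) * (ENNReal.ofReal (2 ^ k) * W)
  push_cast
  rw [mul_assoc]
  gcongr 2 * ?_
  calc _ ≤ 3 * C₀ * Y + 4 * κ * Z := add_le_add hnear hfar
    _ ≤ (3 * C₀ + 4 * κ) * Y + (3 * C₀ + 4 * κ) * Z := by
        gcongr
        · exact le_self_add
        · exact le_add_self
    _ = _ := by ring

theorem tsum_lowHigh_le : ∃ C : ℝ≥0, ∀ u v : Plane → ℝ≥0∞, Measurable u → Measurable v →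
    ∑' k : ℕ, (∫⁻ ξ in annulus k, lowHigh u v ξ ^ 2) ^ (1 / 2 : ℝ)
      ≤ C * (halfNormSq u ^ (1 / 2 : ℝ) * halfNormSq v ^ (1 / 2 : ℝ)) := by
  obtain ⟨C, hC⟩ := setLIntegral_lowHigh_sq_le
  have h0 : (0 : ℝ) ≤ 1 / 2 := by norm_num
  refine ⟨C ^ (1 / 2 : ℝ) * (10 ^ (1 / 2 : ℝ) * 8 ^ (1 / 2 : ℝ) + 8 ^ (1 / 2 : ℝ) * 8 ^ (1 / 2 : ℝ)),
    fun u v hu hv => ?_⟩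
  calc _ ≤ ∑' k : ℕ, (C : ℝ≥0∞) ^ (1 / 2 : ℝ) * (
      ((ENNReal.ofReal ((√2)⁻¹ ^ k) *
        ∫⁻ ζ in Metric.closedBall 0 (4 * 2 ^ k), ENNReal.ofReal (wt ζ) * u ζ ^ 2) *
        (ENNReal.ofReal (2 ^ k) * ∫⁻ ζ in highFreq k, v ζ ^ 2)) ^ (1 / 2 : ℝ) +
      ((ENNReal.ofReal (2 ^ k) * ∫⁻ ζ in highFreq k, u ζ ^ 2) *
        (ENNReal.ofReal (2 ^ k) * ∫⁻ ζ in highFreq k, v ζ ^ 2)) ^ (1 / 2 : ℝ)) := by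
        refine ENNReal.tsum_le_tsum fun k => ?_
        refine (ENNReal.rpow_le_rpow (hC u v hu hv k) h0).trans ?_
        rw [ENNReal.mul_rpow_of_nonneg _ _ h0]
        gcongr
        exact ENNReal.rpow_add_le_add_rpow _ _ h0 (by norm_num)
    _ ≤ (C : ℝ≥0∞) ^ (1 / 2 : ℝ) * (
        (10 * halfNormSq u) ^ (1 / 2 : ℝ) * (8 * halfNormSq v) ^ (1 / 2 : ℝ) +
        (8 * halfNormSq u) ^ (1 / 2 : ℝ) * (8 * halfNormSq v) ^ (1 / 2 : ℝ)) := by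
        rw [ENNReal.tsum_mul_left, ENNReal.tsum_add]
        gcongr
        · exact (tsum_rpow_half_mul_le _ _).trans (mul_le_mul'
            (ENNReal.rpow_le_rpow (tsum_ball_le hu) h0)
            (ENNReal.rpow_le_rpow (tsum_highFreq_le hv) h0))
        · exact (tsum_rpow_half_mul_le _ _).trans (mul_le_mul'
            (ENNReal.rpow_le_rpow (tsum_highFreq_le hu) h0)
            (ENNReal.rpow_le_rpow (tsum_highFreq_le hv) h0))
    _ = _ := by
        simp only [ENNReal.mul_rpow_of_nonneg _ _ h0]
        push_cast [ENNReal.coe_rpow_of_nonneg _ h0]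
        ring

theorem lintegral_sq_le_halfNormSq (u : Plane → ℝ≥0∞) : ∫⁻ ζ, u ζ ^ 2 ≤ halfNormSq u := by
  refine lintegral_mono fun ζ => le_mul_of_one_le_left zero_le ?_
  rw [← ENNReal.ofReal_one]
  exact ENNReal.ofReal_le_ofReal (by linarith [norm_nonneg ζ])

/-- The product estimate `H^{1/2} · H^{1/2} ⊆ B^0_{2,1}` in the plane, on the Fourier side. -/
theorem tsum_conv_le : ∃ C : ℝ≥0, ∀ u v : Plane → ℝ≥0∞, Measurable u → Measurable v →
    ∑' k : ℕ, (∫⁻ ξ in annulus k, conv u v ξ ^ 2) ^ (1 / 2 : ℝ)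
      + (∫⁻ ξ in Metric.closedBall 0 1, conv u v ξ ^ 2) ^ (1 / 2 : ℝ)
      ≤ C * (halfNormSq u ^ (1 / 2 : ℝ) * halfNormSq v ^ (1 / 2 : ℝ)) := by
  obtain ⟨C, hC⟩ := tsum_lowHigh_le
  have h0 : (0 : ℝ) ≤ 1 / 2 := by norm_num
  have hvol : volume (Metric.closedBall (0 : Plane) 1) ≠ ⊤ := (isCompact_closedBall _ _).measure_ne_top
  obtain ⟨κ, hκ⟩ : ∃ κ : ℝ≥0, (κ : ℝ≥0∞) = volume (Metric.closedBall (0 : Plane) 1) :=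
    ⟨_, ENNReal.coe_toNNReal hvol⟩
  refine ⟨2 * 2 ^ (1 / 2 : ℝ) * C + κ ^ (1 / 2 : ℝ), fun u v hu hv => ?_⟩
  set M := halfNormSq u ^ (1 / 2 : ℝ) * halfNormSq v ^ (1 / 2 : ℝ) with hM
  -- At low frequency the uniform bound on the convolution and the finite area of the disc suffice.
  have hlow : (∫⁻ ξ in Metric.closedBall 0 1, conv u v ξ ^ 2) ^ (1 / 2 : ℝ)
      ≤ (κ : ℝ≥0∞) ^ (1 / 2 : ℝ) * M := by
    rw [hM, ← ENNReal.mul_rpow_of_nonneg _ _ h0, ← ENNReal.mul_rpow_of_nonneg _ _ h0]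
    refine ENNReal.rpow_le_rpow ?_ h0
    calc _ ≤ ∫⁻ ξ in Metric.closedBall (0 : Plane) 1, halfNormSq u * halfNormSq v :=
          lintegral_mono fun ξ => (conv_sq_le hu hv ξ).trans
            (mul_le_mul' (lintegral_sq_le_halfNormSq u) (lintegral_sq_le_halfNormSq v))
      _ = _ := by rw [setLIntegral_const, hκ, mul_comm]
  have hhigh : ∑' k : ℕ, (∫⁻ ξ in annulus k, conv u v ξ ^ 2) ^ (1 / 2 : ℝ)
      ≤ 2 ^ (1 / 2 : ℝ) * (C * M + C * M) := by
    have e := hC v u hv hu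
    rw [mul_comm (halfNormSq v ^ _)] at e
    refine le_trans ?_ (mul_le_mul_right (add_le_add (hC u v hu hv) e) _)
    rw [← ENNReal.tsum_add, ← ENNReal.tsum_mul_left]
    refine ENNReal.tsum_le_tsum fun k => ?_
    calc _ ≤ (2 * ((∫⁻ ξ in annulus k, lowHigh u v ξ ^ 2)
          + ∫⁻ ξ in annulus k, lowHigh v u ξ ^ 2)) ^ (1 / 2 : ℝ) := by
          refine ENNReal.rpow_le_rpow ?_ h0
          rw [← lintegral_add_left ((measurable_lowHigh hu hv).pow_const 2),
            ← lintegral_const_mul' _ _ (by norm_num)]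
          refine lintegral_mono fun ξ => ?_
          refine (pow_le_pow_left₀ zero_le (conv_le_lowHigh_add hu hv ξ) 2).trans ?_
          have := ENNReal.rpow_add_le_mul_rpow_add_rpow (lowHigh u v ξ) (lowHigh v u ξ) one_le_two
          norm_num at this
          exact this
      _ ≤ _ := by
          rw [ENNReal.mul_rpow_of_nonneg _ _ h0]
          gcongr
          exact ENNReal.rpow_add_le_add_rpow _ _ h0 (by norm_num)
  refine (add_le_add hhigh hlow).trans (le_of_eq ?_)
  push_cast [ENNReal.coe_rpow_of_nonneg _ h0]
  ring

end Bilinear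
-- Calculus on the slab, vanishing norms and spatial cutoffs.
section Slab

theorem mem_slab {p : ℝ × Plane} : p ∈ slab ↔ p.1 ∈ Icc (0 : ℝ) 1 := by simp [slab]

theorem mk_mem_slab {t : ℝ} (ht : t ∈ Icc (0 : ℝ) 1) (x : Plane) : (t, x) ∈ slab := mem_slab.2 ht

theorem measurableSet_slab : MeasurableSet slab := measurableSet_Icc.prod MeasurableSet.univ

theorem volume_restrict_slab :
    (volume : Measure (ℝ × Plane)).restrict slab = (volume.restrict (Icc (0 : ℝ) 1)).prod volume := by
  rw [slab, Measure.volume_eq_prod, ← Measure.prod_restrict, Measure.restrict_univ]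

theorem uniqueDiffOn_slab : UniqueDiffOn ℝ slab :=
  (uniqueDiffOn_Icc zero_lt_one).prod uniqueDiffOn_univ

/-- The retraction of `ℝ × ℝ²` onto the slab. -/
def clamp (p : ℝ × Plane) : ℝ × Plane := (max 0 (min 1 p.1), p.2)

@[fun_prop]
theorem continuous_clamp : Continuous clamp := by unfold clamp; fun_prop

theorem clamp_mem (p : ℝ × Plane) : clamp p ∈ slab :=
  mem_slab.2 ⟨le_max_left _ _, max_le zero_le_one (min_le_left _ _)⟩

theorem clamp_of_mem {p : ℝ × Plane} (hp : p ∈ slab) : clamp p = p := by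
  have := mem_slab.1 hp
  simp [clamp, this.1, this.2]

theorem continuous_comp_clamp {E : Type*} [TopologicalSpace E] {q : ℝ × Plane → E}
    (hq : ContinuousOn q slab) : Continuous (q ∘ clamp) :=
  hq.comp_continuous continuous_clamp clamp_mem

variable {g h : ℝ × Plane → ℂ}

theorem contDiff_slice (hg : ContDiffOn ℝ ∞ g slab) {t : ℝ} (ht : t ∈ Icc (0 : ℝ) 1) :
    ContDiff ℝ ∞ fun x => g (t, x) :=
  hg.comp_contDiff (by fun_prop) fun x => mk_mem_slab ht x

theorem differentiableWithinAt_slab (hg : ContDiffOn ℝ ∞ g slab) {p : ℝ × Plane} (hp : p ∈ slab) :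
    HasFDerivWithinAt g (fderivWithin ℝ g slab p) slab p :=
  ((hg.differentiableOn (by simp)) p hp).hasFDerivWithinAt

theorem hasDerivWithinAt_time (hg : ContDiffOn ℝ ∞ g slab) {p : ℝ × Plane} (hp : p ∈ slab) :
    HasDerivWithinAt (fun s => g (s, p.2)) (fderivWithin ℝ g slab p (1, 0)) (Icc 0 1) p.1 := by
  have h1 : HasDerivWithinAt (fun s : ℝ => (s, p.2)) (1, 0) (Icc 0 1) p.1 :=
    (hasDerivWithinAt_id _ _).prodMk (hasDerivWithinAt_const _ _ _)
  exact HasFDerivWithinAt.comp_hasDerivWithinAt p.1 (differentiableWithinAt_slab hg hp) h1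
    fun s hs => mk_mem_slab hs _

theorem partialT_eq (hg : ContDiffOn ℝ ∞ g slab) {p : ℝ × Plane} (hp : p ∈ slab) :
    partialT g p = fderivWithin ℝ g slab p (1, 0) :=
  (hasDerivWithinAt_time hg hp).derivWithin (uniqueDiffOn_Icc zero_lt_one _ (mem_slab.1 hp))

theorem hasDerivAt_time (hg : ContDiffOn ℝ ∞ g slab) {t : ℝ} (ht : t ∈ Ioo (0 : ℝ) 1) (x : Plane) :
    HasDerivAt (fun s => g (s, x)) (partialT g (t, x)) t := by
  have hp := mk_mem_slab (Ioo_subset_Icc_self ht) x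
  rw [partialT_eq hg hp]
  exact (hasDerivWithinAt_time hg hp).hasDerivAt (Icc_mem_nhds ht.1 ht.2)

theorem partialX_eq (hg : ContDiffOn ℝ ∞ g slab) {p : ℝ × Plane} (hp : p ∈ slab) (i : Fin 2) :
    partialX i g p = fderivWithin ℝ g slab p (0, EuclideanSpace.single i 1) := by
  have h1 : HasFDerivAt (fun y : Plane => (p.1, y)) (ContinuousLinearMap.inr ℝ ℝ Plane) p.2 :=
    hasFDerivAt_prodMk_right _ _
  have h2 := (differentiableWithinAt_slab hg hp).comp p.2 h1.hasFDerivWithinAt (s := univ)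
    fun y _ => mk_mem_slab (mem_slab.1 hp) y
  rw [hasFDerivWithinAt_univ] at h2
  have h3 : fderiv ℝ (fun y : Plane => g (p.1, y)) p.2 = _ := h2.fderiv
  rw [partialX, h3]
  rfl

theorem contDiffOn_fderivWithin_apply (hg : ContDiffOn ℝ ∞ g slab) (w : ℝ × Plane) :
    ContDiffOn ℝ ∞ (fun p => fderivWithin ℝ g slab p w) slab :=
  (hg.fderivWithin uniqueDiffOn_slab (by simp)).clm_apply contDiffOn_const

theorem contDiffOn_partialT (hg : ContDiffOn ℝ ∞ g slab) : ContDiffOn ℝ ∞ (partialT g) slab :=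
  (contDiffOn_fderivWithin_apply hg _).congr fun _ hp => partialT_eq hg hp

theorem contDiffOn_partialX (hg : ContDiffOn ℝ ∞ g slab) (i : Fin 2) :
    ContDiffOn ℝ ∞ (partialX i g) slab :=
  (contDiffOn_fderivWithin_apply hg _).congr fun _ hp => partialX_eq hg hp i

theorem aestronglyMeasurable_slab (hg : ContinuousOn g slab) :
    AEStronglyMeasurable g (volume.restrict slab) := hg.aestronglyMeasurable measurableSet_slab

theorem aemeasurable_enorm_sq_slab (hg : ContinuousOn g slab) :
    AEMeasurable (fun p => ‖g p‖ₑ ^ 2) (volume.restrict slab) :=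
  (aestronglyMeasurable_slab hg).enorm.pow_const 2

/-- The square of the `H¹` norm. -/
def h1Sq (g : ℝ × Plane → ℂ) : ℝ≥0∞ :=
  ∫⁻ p in slab, (‖g p‖ₑ ^ 2 + ‖partialT g p‖ₑ ^ 2 + ∑ i : Fin 2, ‖partialX i g p‖ₑ ^ 2)

theorem h1Norm_eq (g : ℝ × Plane → ℂ) : h1Norm g = h1Sq g ^ (1 / 2 : ℝ) := rfl

theorem h1Norm_ne_top_iff : h1Norm g ≠ ⊤ ↔ h1Sq g ≠ ⊤ := by
  rw [h1Norm_eq, Ne, ENNReal.rpow_eq_top_iff_of_pos (by norm_num)]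

theorem memLp_two_of_lintegral_ne_top {α : Type*} [MeasurableSpace α] {μ : Measure α} {f : α → ℂ}
    (hf : AEStronglyMeasurable f μ) (h : ∫⁻ x, ‖f x‖ₑ ^ 2 ∂μ ≠ ⊤) : MemLp f 2 μ := by
  refine ⟨hf, ?_⟩
  rw [eLpNorm_lt_top_iff_lintegral_rpow_enorm_lt_top (by norm_num) (by norm_num)]
  simpa using h.lt_top

theorem memLp_slab (hg : ContDiffOn ℝ ∞ g slab) (h : h1Sq g ≠ ⊤) :
    MemLp g 2 (volume.restrict slab) :=
  memLp_two_of_lintegral_ne_top (aestronglyMeasurable_slab hg.continuousOn)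
    (ne_top_of_le_ne_top h (lintegral_mono fun _ => le_add_right le_self_add))

theorem memLp_slab_partialT (hg : ContDiffOn ℝ ∞ g slab) (h : h1Sq g ≠ ⊤) :
    MemLp (partialT g) 2 (volume.restrict slab) :=
  memLp_two_of_lintegral_ne_top (aestronglyMeasurable_slab (contDiffOn_partialT hg).continuousOn)
    (ne_top_of_le_ne_top h (lintegral_mono fun _ => le_add_right le_add_self))

theorem integrable_partialT_mul (hg : ContDiffOn ℝ ∞ g slab) (hh : ContDiffOn ℝ ∞ h slab)
    (hg1 : h1Sq g ≠ ⊤) (hh1 : h1Sq h ≠ ⊤) :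
    Integrable (fun p => partialT g p * h p) (volume.restrict slab) :=
  (memLp_slab_partialT hg hg1).integrable_mul (memLp_slab hh hh1)

theorem bilinearTrace_eq (g h : ℝ × Plane → ℂ) (x : Plane) :
    bilinearTrace g h x = ∫ t in Icc (0 : ℝ) 1, partialT g (t, x) * h (t, x) := by
  rw [bilinearTrace, intervalIntegral.integral_of_le zero_le_one, integral_Icc_eq_integral_Ioc]

theorem integrable_bilinearTrace (hg : ContDiffOn ℝ ∞ g slab) (hh : ContDiffOn ℝ ∞ h slab)
    (hg1 : h1Sq g ≠ ⊤) (hh1 : h1Sq h ≠ ⊤) : Integrable (bilinearTrace g h) := by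
  have h1 := integrable_partialT_mul hg hh hg1 hh1
  rw [volume_restrict_slab] at h1
  simpa only [← bilinearTrace_eq] using h1.integral_prod_right

section ZeroCase

theorem subset_closure_interior_slab : slab ⊆ closure (interior slab) := by
  rw [slab, interior_prod_eq, closure_prod_eq, interior_Icc, closure_Ioo zero_ne_one]
  simp

/-- The slab is contained in the closure of its interior, so almost everywhere vanishing of a
continuous function becomes vanishing everywhere. This settles the case of zero `H¹` norm, where the
other norm may be infinite. -/
theorem eqOn_zero_of_lintegral_eq_zero (hg : ContinuousOn g slab)
    (h : ∫⁻ p in slab, ‖g p‖ₑ ^ 2 = 0) : EqOn g 0 slab := by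
  rw [lintegral_eq_zero_iff' (aemeasurable_enorm_sq_slab hg)] at h
  refine Measure.eqOn_of_ae_eq (μ := volume) ?_ hg continuousOn_const subset_closure_interior_slab
  filter_upwards [h] with p hp
  simpa using hp

theorem bilinearTrace_eq_zero_left (hg : ContDiffOn ℝ ∞ g slab) (h0 : h1Sq g = 0) :
    bilinearTrace g h = 0 := by
  have hz : ∫⁻ p in slab, ‖partialT g p‖ₑ ^ 2 = 0 :=
    le_antisymm (h0 ▸ lintegral_mono fun _ => le_add_right le_add_self) zero_le
  have e := eqOn_zero_of_lintegral_eq_zero (contDiffOn_partialT hg).continuousOn hz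
  ext x
  rw [bilinearTrace_eq]
  refine setIntegral_eq_zero_of_forall_eq_zero fun t ht => ?_
  rw [e (mk_mem_slab ht x)]
  simp

theorem bilinearTrace_eq_zero_right (hh : ContDiffOn ℝ ∞ h slab) (h0 : h1Sq h = 0) :
    bilinearTrace g h = 0 := by
  have hz : ∫⁻ p in slab, ‖h p‖ₑ ^ 2 = 0 :=
    le_antisymm (h0 ▸ lintegral_mono fun _ => le_add_right le_self_add) zero_le
  have e := eqOn_zero_of_lintegral_eq_zero hh.continuousOn hz
  ext x
  rw [bilinearTrace_eq]
  refine setIntegral_eq_zero_of_forall_eq_zero fun t ht => ?_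
  rw [e (mk_mem_slab ht x)]
  simp

end ZeroCase

section Cutoff

/-- Multiplication by a function of the space variable. -/
def mulX (φ : Plane → ℝ) (g : ℝ × Plane → ℂ) (p : ℝ × Plane) : ℂ := φ p.2 * g p

variable {φ : Plane → ℝ}

theorem contDiffOn_mulX (hφ : ContDiff ℝ ∞ φ) (hg : ContDiffOn ℝ ∞ g slab) :
    ContDiffOn ℝ ∞ (mulX φ g) slab := by
  refine ContDiffOn.mul (ContDiff.contDiffOn ?_) hg
  exact Complex.ofRealCLM.contDiff.comp (hφ.comp contDiff_snd)

theorem partialT_mulX (φ : Plane → ℝ) (g : ℝ × Plane → ℂ) (p : ℝ × Plane) :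
    partialT (mulX φ g) p = φ p.2 * partialT g p :=
  derivWithin_const_mul_field (φ p.2 : ℂ) (v := fun s => g (s, p.2))

theorem partialX_mulX (hφ : ContDiff ℝ ∞ φ) (hg : ContDiffOn ℝ ∞ g slab) {p : ℝ × Plane}
    (hp : p ∈ slab) (i : Fin 2) :
    partialX i (mulX φ g) p
      = φ p.2 * partialX i g p + (fderiv ℝ φ p.2 (EuclideanSpace.single i 1) : ℝ) * g p := by
  have h1 : HasFDerivAt (fun y => (φ y : ℂ)) (Complex.ofRealCLM.comp (fderiv ℝ φ p.2)) p.2 :=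
    Complex.ofRealCLM.hasFDerivAt.comp p.2 (hφ.differentiable (by simp) p.2).hasFDerivAt
  have h2 : HasFDerivAt (fun y => g (p.1, y)) (fderiv ℝ (fun y => g (p.1, y)) p.2) p.2 :=
    ((contDiff_slice hg (mem_slab.1 hp)).differentiable (by simp) p.2).hasFDerivAt
  have h3 : fderiv ℝ (fun y : Plane => mulX φ g (p.1, y)) p.2 = _ := (h1.mul h2).fderiv
  rw [partialX, h3]
  simp [partialX, mul_comm]

theorem bilinearTrace_mulX (φ : Plane → ℝ) (g h : ℝ × Plane → ℂ) (x : Plane) :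
    bilinearTrace (mulX φ g) (mulX φ h) x = (φ x : ℂ) ^ 2 * bilinearTrace g h x := by
  rw [bilinearTrace, bilinearTrace, ← intervalIntegral.integral_const_mul]
  refine intervalIntegral.integral_congr fun t _ => ?_
  simp only [partialT_mulX, mulX]
  ring

theorem enorm_add_sq_le (x y : ℂ) : ‖x + y‖ₑ ^ 2 ≤ 2 * (‖x‖ₑ ^ 2 + ‖y‖ₑ ^ 2) := by
  refine (pow_le_pow_left₀ zero_le (enorm_add_le x y) 2).trans ?_
  have := ENNReal.rpow_add_le_mul_rpow_add_rpow ‖x‖ₑ ‖y‖ₑ one_le_two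
  norm_num at this
  exact this

/-- The product rule produces `∂_i φ · g`; two directions, each with `2 L² |g|²`, account for `4
L²`. The bound depends on `φ` only through `L`, so it is uniform along the exhaustion. -/
theorem h1Sq_mulX_le (hφ : ContDiff ℝ ∞ φ) (hg : ContDiffOn ℝ ∞ g slab) {L : ℝ≥0}
    (h1 : ∀ x, |φ x| ≤ 1) (hL : ∀ x, ‖fderiv ℝ φ x‖ ≤ L) :
    h1Sq (mulX φ g) ≤ (2 + 4 * (L : ℝ≥0∞) ^ 2) * h1Sq g := by
  have e1 : ∀ x, ‖(φ x : ℂ)‖ₑ ≤ 1 := fun x => by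
    rw [← ofReal_norm, Complex.norm_real, ← ENNReal.ofReal_one]
    exact ENNReal.ofReal_le_ofReal (h1 x)
  have m1 : ∀ (x : Plane) (z : ℂ), ‖(φ x : ℂ) * z‖ₑ ^ 2 ≤ ‖z‖ₑ ^ 2 := fun x z => by
    rw [enorm_mul]
    gcongr
    exact mul_le_of_le_one_left zero_le (e1 x)
  have m2 : ∀ (x : Plane) (i : Fin 2) (z : ℂ),
      ‖((fderiv ℝ φ x (EuclideanSpace.single i 1) : ℝ) : ℂ) * z‖ₑ ^ 2 ≤ L ^ 2 * ‖z‖ₑ ^ 2 :=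
    fun x i z => by
      rw [enorm_mul, mul_pow]
      gcongr
      rw [← ofReal_norm, Complex.norm_real, ← ENNReal.ofReal_coe_nnreal]
      refine ENNReal.ofReal_le_ofReal ?_
      refine ((fderiv ℝ φ x).le_opNorm _).trans ?_
      simpa using hL x
  rw [h1Sq, h1Sq, ← lintegral_const_mul' _ _ (by finiteness)]
  refine setLIntegral_mono' measurableSet_slab fun p hp => ?_
  have m3 : ∀ i, ‖partialX i (mulX φ g) p‖ₑ ^ 2
      ≤ 2 * (‖partialX i g p‖ₑ ^ 2 + L ^ 2 * ‖g p‖ₑ ^ 2) := fun i => by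
    rw [partialX_mulX hφ hg hp]
    exact (enorm_add_sq_le _ _).trans (mul_le_mul_right (add_le_add (m1 _ _) (m2 _ _ _)) _)
  rw [partialT_mulX]
  simp only [Fin.sum_univ_two]
  calc _ ≤ ‖g p‖ₑ ^ 2 + ‖partialT g p‖ₑ ^ 2 + (2 * (‖partialX 0 g p‖ₑ ^ 2 + L ^ 2 * ‖g p‖ₑ ^ 2)
        + 2 * (‖partialX 1 g p‖ₑ ^ 2 + L ^ 2 * ‖g p‖ₑ ^ 2)) :=
        add_le_add (add_le_add (m1 _ _) (m1 _ _)) (add_le_add (m3 0) (m3 1))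
    _ ≤ _ := by
        set a := ‖g p‖ₑ ^ 2
        set b := ‖partialT g p‖ₑ ^ 2
        set c := ‖partialX 0 g p‖ₑ ^ 2
        set d := ‖partialX 1 g p‖ₑ ^ 2
        have : (2 + 4 * (L : ℝ≥0∞) ^ 2) * (a + b + (c + d))
          = (a + b + (2 * (c + L ^ 2 * a) + 2 * (d + L ^ 2 * a)))
            + (a + b + 4 * L ^ 2 * (b + c + d)) := by ring
        rw [this]
        exact le_self_add

/-- There are smooth cutoffs with uniformly bounded gradients that exhaust the plane. -/
theorem exists_cutoffs : ∃ (φ : ℕ → Plane → ℝ) (L : ℝ≥0), (∀ n, ContDiff ℝ ∞ (φ n)) ∧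
    (∀ n, HasCompactSupport (φ n)) ∧ (∀ n x, |φ n x| ≤ 1) ∧ (∀ n x, ‖fderiv ℝ (φ n) x‖ ≤ L) ∧
    ∀ x, Filter.Tendsto (fun n => φ n x) Filter.atTop (nhds 1) := by
  let b : ContDiffBump (0 : Plane) := ⟨1, 2, one_pos, one_lt_two⟩
  have hb : ContDiff ℝ ∞ b := b.contDiff
  obtain ⟨M, hM⟩ := (b.hasCompactSupport.fderiv (𝕜 := ℝ)).exists_bound_of_continuous
    (hb.continuous_fderiv (by simp))
  have hM0 : 0 ≤ M := (norm_nonneg _).trans (hM 0)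
  have hd : ∀ n : ℕ, ((n : ℝ) + 1)⁻¹ ≤ 1 := fun n => inv_le_one_of_one_le₀ (by simp)
  have hpos : ∀ n : ℕ, 0 < ((n : ℝ) + 1)⁻¹ := fun n => by positivity
  refine ⟨fun n x => b (((n : ℝ) + 1)⁻¹ • x), ⟨M, hM0⟩, fun n => by fun_prop, fun n => ?_,
    fun n x => ?_, fun n x => ?_, fun x => ?_⟩
  · exact b.hasCompactSupport.comp_homeomorph (Homeomorph.smulOfNeZero _ (hpos n).ne')
  · rw [abs_of_nonneg b.nonneg]
    exact b.le_one
  · have h1 : HasFDerivAt (fun x : Plane => ((n : ℝ) + 1)⁻¹ • x)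
        (((n : ℝ) + 1)⁻¹ • ContinuousLinearMap.id ℝ Plane) x :=
      (((n : ℝ) + 1)⁻¹ • ContinuousLinearMap.id ℝ Plane).hasFDerivAt
    have h2 := ((hb.differentiable (by simp) (((n : ℝ) + 1)⁻¹ • x)).hasFDerivAt.comp x h1).fderiv
    change ‖fderiv ℝ (b ∘ fun x => ((n : ℝ) + 1)⁻¹ • x) x‖ ≤ M
    rw [h2, ContinuousLinearMap.comp_smul, ContinuousLinearMap.comp_id, norm_smul,
      Real.norm_of_nonneg (hpos n).le]
    exact (mul_le_of_le_one_left (norm_nonneg _) (hd n)).trans (hM _)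
  · refine tendsto_const_nhds.congr' ?_
    obtain ⟨N, hN⟩ := exists_nat_ge ‖x‖
    filter_upwards [Filter.eventually_ge_atTop N] with n hn
    refine (b.one_of_mem_closedBall ?_).symm
    have : (N : ℝ) ≤ n := by exact_mod_cast hn
    rw [mem_closedBall_zero_iff, norm_smul, Real.norm_of_nonneg (hpos n).le,
      inv_mul_le_iff₀ (by positivity)]
    change ‖x‖ ≤ ((n : ℝ) + 1) * 1
    linarith

end Cutoff

end Slab
-- The spatial Fourier transform of functions on the slab.
section SliceFourier

/-- The Fourier transform in the space variable. -/
def sliceFourier (q : ℝ × Plane → ℂ) (p : ℝ × Plane) : ℂ := 𝓕 (fun x => q (p.1, x)) p.2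

/-- On the slab, `q` vanishes where the space variable is outside `K`. -/
def SpaceSupportedIn (K : Set Plane) (q : ℝ × Plane → ℂ) : Prop := ∀ p ∈ slab, p.2 ∉ K → q p = 0

variable {K : Set Plane} {g h q : ℝ × Plane → ℂ}

theorem SpaceSupportedIn.partialT (hq : SpaceSupportedIn K q) :
    SpaceSupportedIn K (partialT q) := fun p hp hpK => by
  have : EqOn (fun s => q (s, p.2)) (fun _ => 0) (Icc 0 1) := fun s hs =>
    hq _ (mk_mem_slab hs _) hpK
  rw [SharpTrace.partialT, derivWithin_congr this (this (mem_slab.1 hp)), derivWithin_fun_const]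
  rfl

/-- A time slice, as a Schwartz function. -/
def sliceSchwartz (hK : IsCompact K) (hq : ContDiffOn ℝ ∞ q slab) (hqK : SpaceSupportedIn K q)
    {t : ℝ} (ht : t ∈ Icc (0 : ℝ) 1) : SchwartzMap Plane ℂ :=
  (HasCompactSupport.intro (f := fun x => q (t, x)) hK fun _ hx =>
    hqK _ (mk_mem_slab ht _) hx).toSchwartzMap (contDiff_slice hq ht)

theorem continuousOn_sliceFourier (hK : IsCompact K) (hq : ContinuousOn q slab)
    (hqK : SpaceSupportedIn K q) : ContinuousOn (sliceFourier q) slab := by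
  have h := continuousOn_integral_of_compact_support (μ := (volume : Measure Plane))
    (f := fun (p : ℝ × Plane) (x : Plane) => (Real.fourierChar (-inner ℝ x p.2) : ℂ) * q (p.1, x))
    (s := slab) hK ?_ fun p x hp hx => by
      rw [hqK _ (mk_mem_slab (mem_slab.1 hp) x) hx, mul_zero]
  · refine h.congr fun p _ => ?_
    rw [sliceFourier, Real.fourier_eq]
    rfl
  · refine ContinuousOn.mul (Continuous.continuousOn ?_) ?_
    · have := Real.continuous_fourierChar
      fun_prop
    · exact hq.comp (by fun_prop) fun p hp => mk_mem_slab (mem_slab.1 hp.1) _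

theorem integrable_slice (hK : IsCompact K) (hq : ContDiffOn ℝ ∞ q slab)
    (hqK : SpaceSupportedIn K q) {t : ℝ} (ht : t ∈ Icc (0 : ℝ) 1) :
    Integrable fun x => q (t, x) :=
  (sliceSchwartz hK hq hqK ht).integrable

/-- Differentiation under the integral sign, dominated by the maximum of `|∂_t q|` on the compact
set `I × K`. -/
theorem hasDerivAt_sliceFourier (hK : IsCompact K) (hq : ContDiffOn ℝ ∞ q slab)
    (hqK : SpaceSupportedIn K q) {t : ℝ} (ht : t ∈ Ioo (0 : ℝ) 1) (ξ : Plane) :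
    HasDerivAt (fun s => sliceFourier q (s, ξ)) (sliceFourier (partialT q) (t, ξ)) t := by
  have hT := contDiffOn_partialT hq
  obtain ⟨M, hM⟩ := (isCompact_Icc.prod hK).exists_bound_of_continuousOn
    (hT.continuousOn.mono (prod_mono_right (subset_univ K)) :
      ContinuousOn (partialT q) (Icc (0 : ℝ) 1 ×ˢ K))
  have hchar : Continuous fun x : Plane => (Real.fourierChar (-inner ℝ x ξ) : ℂ) := by
    have := Real.continuous_fourierChar
    fun_prop
  have hmeas : ∀ {r : ℝ × Plane → ℂ}, ContDiffOn ℝ ∞ r slab → ∀ s ∈ Icc (0 : ℝ) 1,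
      Continuous fun x => (Real.fourierChar (-inner ℝ x ξ) : ℂ) * r (s, x) := fun hr s hs =>
    hchar.mul (contDiff_slice hr hs).continuous
  have ht' := Ioo_subset_Icc_self ht
  have h := (hasDerivAt_integral_of_dominated_loc_of_deriv_le (μ := (volume : Measure Plane))
    (F := fun s x => (Real.fourierChar (-inner ℝ x ξ) : ℂ) * q (s, x))
    (F' := fun s x => (Real.fourierChar (-inner ℝ x ξ) : ℂ) * partialT q (s, x))
    (bound := K.indicator fun _ => M) (Ioo_mem_nhds ht.1 ht.2) ?_ ?_ ?_ ?_ ?_ ?_).2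
  · convert! h using 1
  · filter_upwards [Ioo_mem_nhds ht.1 ht.2] with s hs
    exact (hmeas hq s (Ioo_subset_Icc_self hs)).aestronglyMeasurable
  · refine (integrable_slice hK hq hqK ht').bdd_mul (c := 1) hchar.aestronglyMeasurable
      (.of_forall fun x => (Circle.norm_coe _).le)
  · exact (hmeas hT t ht').aestronglyMeasurable
  · refine .of_forall fun x s hs => ?_
    rw [norm_mul, Circle.norm_coe, one_mul]
    have hs' := Ioo_subset_Icc_self hs
    by_cases hx : x ∈ K
    · rw [indicator_of_mem hx]
      exact hM _ ⟨hs', hx⟩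
    · rw [hqK.partialT _ (mk_mem_slab hs' x) hx, norm_zero, indicator_of_notMem hx]
  · rw [integrable_indicator_iff hK.measurableSet]
    exact integrableOn_const hK.measure_ne_top
  · exact .of_forall fun x s hs => (hasDerivAt_time hq hs x).const_mul _

theorem lintegral_sliceFourier_sq (hK : IsCompact K) (hq : ContDiffOn ℝ ∞ q slab)
    (hqK : SpaceSupportedIn K q) {t : ℝ} (ht : t ∈ Icc (0 : ℝ) 1) :
    ∫⁻ ξ, ‖sliceFourier q (t, ξ)‖ₑ ^ 2 = ∫⁻ x, ‖q (t, x)‖ₑ ^ 2 :=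
  lintegral_enorm_sq_fourier (sliceSchwartz hK hq hqK ht)

open SchwartzMap in
theorem lintegral_inner_mul_fourier_sq_le (u : 𝓢(Plane, ℂ)) (i : Fin 2) :
    ∫⁻ ξ, ENNReal.ofReal (ξ i ^ 2) * ‖𝓕 (u : Plane → ℂ) ξ‖ₑ ^ 2
      ≤ ∫⁻ x, ‖fderiv ℝ u x (EuclideanSpace.single i 1)‖ₑ ^ 2 := by
  have h := lintegral_enorm_sq_fourier (LineDeriv.lineDerivOp (EuclideanSpace.single i (1 : ℝ)) u)
  have e : ((LineDeriv.lineDerivOp (EuclideanSpace.single i (1 : ℝ)) u : 𝓢(Plane, ℂ)) : Plane → ℂ)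
    = fun x => fderiv ℝ u x (EuclideanSpace.single i 1) := rfl
  rw [e] at h
  rw [← h]
  refine lintegral_mono fun ξ => ?_
  rw [fourier_fderiv_apply, enorm_mul, mul_pow]
  gcongr
  rw [← ofReal_norm, ← ENNReal.ofReal_pow (norm_nonneg _)]
  refine ENNReal.ofReal_le_ofReal ?_
  have hin : inner ℝ ξ (EuclideanSpace.single i (1 : ℝ)) = ξ i := by
    simp [EuclideanSpace.inner_single_right]
  rw [hin, norm_mul, norm_mul, norm_mul, Complex.norm_I, Complex.norm_two, Complex.norm_real,
    Complex.norm_real, Real.norm_of_nonneg Real.pi_pos.le, mul_pow, Real.norm_eq_abs, sq_abs]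
  -- The multiplier of `∂_i` is `2πi ξ_i`; the factor `(2π)² ≥ 1` is discarded.
  refine le_mul_of_one_le_left (sq_nonneg _) ?_
  nlinarith [Real.pi_gt_three]

/-- Plancherel for the slice and its gradient, after `(1 + |ξ|)² ≤ 2 (1 + |ξ|²)`. -/
theorem lintegral_weight_mul_sliceFourier_sq_le (hK : IsCompact K) (hq : ContDiffOn ℝ ∞ q slab)
    (hqK : SpaceSupportedIn K q) {t : ℝ} (ht : t ∈ Icc (0 : ℝ) 1) :
    ∫⁻ ξ, ENNReal.ofReal ((1 + ‖ξ‖) ^ 2) * ‖sliceFourier q (t, ξ)‖ₑ ^ 2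
      ≤ 2 * ((∫⁻ x, ‖q (t, x)‖ₑ ^ 2) + ∑ i : Fin 2, ∫⁻ x, ‖partialX i q (t, x)‖ₑ ^ 2) := by
  have hm : Measurable fun ξ => ‖sliceFourier q (t, ξ)‖ₑ ^ 2 := by
    have : Continuous fun ξ => sliceFourier q (t, ξ) :=
      continuous_fourier_of_integrable (integrable_slice hK hq hqK ht)
    exact this.enorm.measurable.pow_const 2
  have hx : ∀ i : Fin 2, ∫⁻ ξ, ENNReal.ofReal (ξ i ^ 2) * ‖sliceFourier q (t, ξ)‖ₑ ^ 2
      ≤ ∫⁻ x, ‖partialX i q (t, x)‖ₑ ^ 2 := fun i =>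
    lintegral_inner_mul_fourier_sq_le (sliceSchwartz hK hq hqK ht) i
  calc _ ≤ ∫⁻ ξ, 2 * (‖sliceFourier q (t, ξ)‖ₑ ^ 2
        + ∑ i : Fin 2, ENNReal.ofReal (ξ i ^ 2) * ‖sliceFourier q (t, ξ)‖ₑ ^ 2) := by
        refine lintegral_mono fun ξ => ?_
        rw [← Finset.sum_mul, ← ENNReal.ofReal_sum_of_nonneg fun _ _ => sq_nonneg _]
        have hn : ∑ i : Fin 2, ξ i ^ 2 = ‖ξ‖ ^ 2 := by rw [EuclideanSpace.real_norm_sq_eq]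
        have htwo : ∀ r : ℝ, 2 * ENNReal.ofReal r = ENNReal.ofReal (2 * r) := fun r => by
          rw [ENNReal.ofReal_mul zero_le_two, ENNReal.ofReal_ofNat]
        rw [hn]
        nth_rw 2 [← one_mul (‖sliceFourier q (t, ξ)‖ₑ ^ 2)]
        rw [← add_mul, ← mul_assoc, ← ENNReal.ofReal_one, ← ENNReal.ofReal_add zero_le_one (sq_nonneg _),
          htwo]
        gcongr
        nlinarith [sq_nonneg (1 - ‖ξ‖)]
    _ = 2 * ((∫⁻ ξ, ‖sliceFourier q (t, ξ)‖ₑ ^ 2)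
        + ∑ i : Fin 2, ∫⁻ ξ, ENNReal.ofReal (ξ i ^ 2) * ‖sliceFourier q (t, ξ)‖ₑ ^ 2) := by
        rw [lintegral_const_mul' _ _ (by norm_num), lintegral_add_left hm,
          lintegral_finsetSum _ fun i _ => by fun_prop]
    _ ≤ _ := by
        rw [lintegral_sliceFourier_sq hK hq hqK ht]
        exact mul_le_mul_right (add_le_add le_rfl (Finset.sum_le_sum fun i _ => hx i)) _

/-- The energy in time at the frequency `ξ`. -/
def freqEnergy (q : ℝ × Plane → ℂ) (ξ : Plane) : ℝ :=
  energy (1 + ‖ξ‖) (fun t => sliceFourier q (t, ξ)) fun t => sliceFourier (partialT q) (t, ξ)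

/-- The majorant of the spatial Fourier transform that carries half a derivative. -/
def majorant (q : ℝ × Plane → ℂ) (ξ : Plane) : ℝ≥0∞ :=
  ENNReal.ofReal √(freqEnergy q ξ / (1 + ‖ξ‖))

/-- The density of `freqEnergy`. -/
def freqDensity (q : ℝ × Plane → ℂ) (p : ℝ × Plane) : ℝ :=
  (1 + ‖p.2‖) ^ 2 * ‖sliceFourier q p‖ ^ 2 + ‖sliceFourier (partialT q) p‖ ^ 2

theorem freqDensity_nonneg (q : ℝ × Plane → ℂ) (p : ℝ × Plane) : 0 ≤ freqDensity q p := by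
  unfold freqDensity; positivity

theorem continuousOn_freqDensity (hK : IsCompact K) (hq : ContDiffOn ℝ ∞ q slab)
    (hqK : SpaceSupportedIn K q) : ContinuousOn (freqDensity q) slab := by
  have h1 := continuousOn_sliceFourier hK hq.continuousOn hqK
  have h2 := continuousOn_sliceFourier hK (contDiffOn_partialT hq).continuousOn hqK.partialT
  unfold freqDensity
  fun_prop

/-- The density is known to be continuous only on the slab. Clamping makes the integrand continuous
everywhere, as needed for measurability in `ξ` and for Tonelli. -/
theorem freqEnergy_eq (q : ℝ × Plane → ℂ) (ξ : Plane) :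
    freqEnergy q ξ = ∫ t in Icc (0 : ℝ) 1, freqDensity q (clamp (t, ξ)) := by
  rw [freqEnergy, energy, intervalIntegral.integral_of_le zero_le_one, integral_Icc_eq_integral_Ioc]
  refine setIntegral_congr_fun measurableSet_Ioc fun t ht => ?_
  rw [clamp_of_mem (mk_mem_slab (Ioc_subset_Icc_self ht) ξ)]
  rfl

theorem measurable_majorant (hK : IsCompact K) (hq : ContDiffOn ℝ ∞ q slab)
    (hqK : SpaceSupportedIn K q) : Measurable (majorant q) := by
  have h := continuous_comp_clamp (continuousOn_freqDensity hK hq hqK)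
  have h1 : Continuous (freqEnergy q) := by
    have : freqEnergy q = fun ξ => ∫ t in Icc (0 : ℝ) 1, freqDensity q (clamp (t, ξ)) :=
      funext (freqEnergy_eq q)
    rw [this]
    exact continuous_parametric_integral_of_continuous
      (f := fun (ξ : Plane) (t : ℝ) => freqDensity q (clamp (t, ξ)))
      (h.comp continuous_swap) isCompact_Icc
  unfold majorant
  have := h1.measurable
  fun_prop

/-- The weight `1 + |ξ|` cancels the division in the majorant and leaves the energy itself; Tonelli
and Plancherel on each time slice turn it into the `H¹` integral. -/
theorem halfNormSq_majorant_le (hK : IsCompact K) (hq : ContDiffOn ℝ ∞ q slab)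
    (hqK : SpaceSupportedIn K q) : halfNormSq (majorant q) ≤ 2 * h1Sq q := by
  have hc := continuous_comp_clamp (continuousOn_freqDensity hK hq hqK)
  have hslice : ∀ {r : ℝ × Plane → ℂ}, ContDiffOn ℝ ∞ r slab → ∀ {t : ℝ}, t ∈ Icc (0 : ℝ) 1 →
      Measurable fun x => ‖r (t, x)‖ₑ ^ 2 := fun hr t ht => by
    have := (contDiff_slice hr ht).continuous
    exact this.enorm.measurable.pow_const 2
  have hX := fun i => contDiffOn_partialX hq i
  have e1 : ∀ ξ, ENNReal.ofReal (1 + ‖ξ‖) * majorant q ξ ^ 2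
      = ∫⁻ t in Icc (0 : ℝ) 1, ENNReal.ofReal (freqDensity q (clamp (t, ξ))) := fun ξ => by
    have hE : 0 ≤ freqEnergy q ξ := energy_nonneg
    rw [majorant, ← ENNReal.ofReal_pow (Real.sqrt_nonneg _), Real.sq_sqrt (by positivity),
      ← ENNReal.ofReal_mul (by positivity), mul_div_cancel₀ _ (by positivity), freqEnergy_eq,
      ofReal_integral_eq_lintegral_ofReal _ (.of_forall fun t => freqDensity_nonneg _ _)]
    exact (Continuous.integrableOn_Icc (hc.comp (Continuous.prodMk_left ξ)))
  have e2 : ∀ p, ENNReal.ofReal (freqDensity q p) = ENNReal.ofReal ((1 + ‖p.2‖) ^ 2) *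
      ‖sliceFourier q p‖ₑ ^ 2 + ‖sliceFourier (partialT q) p‖ₑ ^ 2 := fun p => by
    rw [freqDensity, ENNReal.ofReal_add (by positivity) (by positivity),
      ENNReal.ofReal_mul (by positivity), ENNReal.ofReal_pow (norm_nonneg (sliceFourier q p)),
      ENNReal.ofReal_pow (norm_nonneg _), ofReal_norm, ofReal_norm]
  have e3 : h1Sq q = ∫⁻ t in Icc (0 : ℝ) 1, ∫⁻ x, (‖q (t, x)‖ₑ ^ 2 + ‖partialT q (t, x)‖ₑ ^ 2
      + ∑ i : Fin 2, ‖partialX i q (t, x)‖ₑ ^ 2) := by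
    rw [h1Sq, volume_restrict_slab, lintegral_prod]
    rw [← volume_restrict_slab]
    refine ((aemeasurable_enorm_sq_slab hq.continuousOn).add
      (aemeasurable_enorm_sq_slab (contDiffOn_partialT hq).continuousOn)).add ?_
    exact Finset.aemeasurable_fun_sum _ fun i _ => aemeasurable_enorm_sq_slab (hX i).continuousOn
  rw [halfNormSq, lintegral_congr e1, lintegral_lintegral_swap, e3,
    ← lintegral_const_mul' _ _ (by norm_num)]
  swap
  · exact (hc.comp continuous_swap).measurable.ennreal_ofReal.aemeasurable
  refine setLIntegral_mono' measurableSet_Icc fun t ht => ?_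
  have hm : Measurable fun ξ => ‖sliceFourier q (t, ξ)‖ₑ ^ 2 := by
    have : Continuous fun ξ => sliceFourier q (t, ξ) :=
      continuous_fourier_of_integrable (integrable_slice hK hq hqK ht)
    exact this.enorm.measurable.pow_const 2
  have hT := contDiffOn_partialT hq
  calc _ = (∫⁻ ξ, ENNReal.ofReal ((1 + ‖ξ‖) ^ 2) * ‖sliceFourier q (t, ξ)‖ₑ ^ 2)
        + ∫⁻ ξ, ‖sliceFourier (partialT q) (t, ξ)‖ₑ ^ 2 := by
        rw [← lintegral_add_left (by fun_prop)]
        refine lintegral_congr fun ξ => ?_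
        rw [clamp_of_mem (mk_mem_slab ht ξ), e2]
    _ ≤ 2 * ((∫⁻ x, ‖q (t, x)‖ₑ ^ 2) + ∑ i : Fin 2, ∫⁻ x, ‖partialX i q (t, x)‖ₑ ^ 2)
        + 2 * ∫⁻ x, ‖partialT q (t, x)‖ₑ ^ 2 := by
        rw [lintegral_sliceFourier_sq hK hT hqK.partialT ht]
        refine add_le_add (lintegral_weight_mul_sliceFourier_sq_le hK hq hqK ht) ?_
        exact le_mul_of_one_le_left zero_le one_le_two
    _ = _ := by
        have ha := hslice hq ht
        have hb := hslice hT ht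
        rw [lintegral_add_left (by fun_prop), lintegral_add_left ha,
          lintegral_finsetSum _ fun i _ => hslice (hX i) ht]
        ring

theorem enorm_integral_sliceFourier_le (hK : IsCompact K) (hg : ContDiffOn ℝ ∞ g slab)
    (hgK : SpaceSupportedIn K g) (hh : ContDiffOn ℝ ∞ h slab) (hhK : SpaceSupportedIn K h)
    (ζ η : Plane) :
    ‖∫ t in Icc (0 : ℝ) 1, sliceFourier (partialT g) (t, ζ) * sliceFourier h (t, η)‖ₑ
      ≤ 5 * (majorant g ζ * majorant h η) := by
  have hc : ∀ {r : ℝ × Plane → ℂ} (ξ : Plane), ContDiffOn ℝ ∞ r slab → SpaceSupportedIn K r →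
      ContinuousOn (fun t => sliceFourier r (t, ξ)) (Icc 0 1) := fun ξ hr hrK =>
    (continuousOn_sliceFourier hK hr.continuousOn hrK).comp (by fun_prop)
      fun t ht => mk_mem_slab ht ξ
  have h1 := norm_integral_deriv_mul_le (α := 1 + ‖ζ‖) (β := 1 + ‖η‖)
    (le_add_of_nonneg_right (norm_nonneg _)) (le_add_of_nonneg_right (norm_nonneg _))
    (hc ζ hg hgK) (hc ζ (contDiffOn_partialT hg) hgK.partialT)
    (fun t ht => hasDerivAt_sliceFourier hK hg hgK ht ζ)
    (hc η hh hhK) (hc η (contDiffOn_partialT hh) hhK.partialT)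
    (fun t ht => hasDerivAt_sliceFourier hK hh hhK ht η)
  rw [integral_Icc_eq_integral_Ioc, ← intervalIntegral.integral_of_le zero_le_one, ← ofReal_norm]
  refine (ENNReal.ofReal_le_ofReal h1).trans (le_of_eq ?_)
  rw [ENNReal.ofReal_mul (by norm_num), ENNReal.ofReal_mul (Real.sqrt_nonneg _),
    ENNReal.ofReal_ofNat]
  rfl

/-- Fubini is used twice, around the product-to-convolution formula on each time slice. -/
theorem fourier_bilinearTrace (hK : IsCompact K) (hg : ContDiffOn ℝ ∞ g slab)
    (hgK : SpaceSupportedIn K g) (hh : ContDiffOn ℝ ∞ h slab) (hhK : SpaceSupportedIn K h)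
    (hg1 : h1Sq g ≠ ⊤) (hh1 : h1Sq h ≠ ⊤) (ξ : Plane) :
    𝓕 (bilinearTrace g h) ξ = ∫ η, ∫ t in Icc (0 : ℝ) 1,
      sliceFourier (partialT g) (t, ξ - η) * sliceFourier h (t, η) := by
  have hT := contDiffOn_partialT hg
  have hchar : Continuous fun p : ℝ × Plane => (Real.fourierChar (-inner ℝ p.2 ξ) : ℂ) := by
    have := Real.continuous_fourierChar
    fun_prop
  have hint : Integrable (fun p : ℝ × Plane => (Real.fourierChar (-inner ℝ p.2 ξ) : ℂ) *
      (partialT g p * h p)) ((volume.restrict (Icc (0 : ℝ) 1)).prod volume) := by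
    rw [← volume_restrict_slab]
    exact (integrable_partialT_mul hg hh hg1 hh1).bdd_mul (c := 1) hchar.aestronglyMeasurable
      (.of_forall fun p => (Circle.norm_coe _).le)
  -- The map `A` preserves Lebesgue integrals, so Plancherel on slices gives the `L²` bound. It is
  -- used for `η ↦ ξ - η` and for the identity, which makes the second Fubini legitimate.
  have hl2 : ∀ {r : ℝ × Plane → ℂ}, ContDiffOn ℝ ∞ r slab → SpaceSupportedIn K r →
      MemLp r 2 (volume.restrict slab) → ∀ A : Plane → Plane, Continuous A →
      (∀ f : Plane → ℝ≥0∞, ∫⁻ η, f (A η) = ∫⁻ η, f η) →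
      MemLp (fun p : ℝ × Plane => sliceFourier r (p.1, A p.2)) 2
        ((volume.restrict (Icc (0 : ℝ) 1)).prod volume) := by
    intro r hr hrK hr2 A hA hinv
    have hcont : ContinuousOn (fun p : ℝ × Plane => sliceFourier r (p.1, A p.2)) slab :=
      (continuousOn_sliceFourier hK hr.continuousOn hrK).comp (by fun_prop)
        fun p hp => mk_mem_slab (mem_slab.1 hp) _
    have hae := aestronglyMeasurable_slab hcont
    have hae2 := aemeasurable_enorm_sq_slab hcont
    have hae3 := aemeasurable_enorm_sq_slab hr.continuousOn
    have hfin := (eLpNorm_lt_top_iff_lintegral_rpow_enorm_lt_top (by norm_num) (by norm_num)).1 hr2.2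
    simp only [ENNReal.toReal_ofNat, ENNReal.rpow_ofNat] at hfin
    rw [volume_restrict_slab] at hae hae2 hae3 hfin
    refine memLp_two_of_lintegral_ne_top hae (ne_of_lt (lt_of_le_of_lt (le_of_eq ?_) hfin))
    rw [lintegral_prod _ hae2, lintegral_prod _ hae3]
    refine setLIntegral_congr_fun measurableSet_Icc fun t ht => ?_
    simp only
    rw [hinv fun η => ‖sliceFourier r (t, η)‖ₑ ^ 2, lintegral_sliceFourier_sq hK hr hrK ht]
  have hint2 : Integrable (fun p : ℝ × Plane => sliceFourier (partialT g) (p.1, ξ - p.2) *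
      sliceFourier h p) ((volume.restrict (Icc (0 : ℝ) 1)).prod volume) :=
    (hl2 hT hgK.partialT (memLp_slab_partialT hg hg1) (fun η => ξ - η) (by fun_prop)
      fun f => lintegral_sub_left_eq_self f ξ).integrable_mul
      (hl2 hh hhK (memLp_slab hh hh1) id continuous_id fun _ => rfl)
  calc 𝓕 (bilinearTrace g h) ξ
      = ∫ x, ∫ t in Icc (0 : ℝ) 1, (Real.fourierChar (-inner ℝ x ξ) : ℂ) *
          (partialT g (t, x) * h (t, x)) := by
        rw [Real.fourier_eq]
        refine integral_congr_ae (.of_forall fun x => ?_)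
        simp only
        rw [bilinearTrace_eq, integral_const_mul]
        rfl
    _ = ∫ t in Icc (0 : ℝ) 1, ∫ x, (Real.fourierChar (-inner ℝ x ξ) : ℂ) *
          (partialT g (t, x) * h (t, x)) := (integral_integral_swap hint).symm
    _ = ∫ t in Icc (0 : ℝ) 1, ∫ η,
          sliceFourier (partialT g) (t, ξ - η) * sliceFourier h (t, η) := by
        refine setIntegral_congr_fun measurableSet_Icc fun t ht => ?_
        exact fourier_mul_eq_integral (sliceSchwartz hK hT hgK.partialT ht)
          (sliceSchwartz hK hh hhK ht) ξ
    _ = _ := integral_integral_swap hint2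

/-- The Fourier transform of the bilinear trace is dominated by a convolution. -/
theorem enorm_fourier_bilinearTrace_le (hK : IsCompact K) (hg : ContDiffOn ℝ ∞ g slab)
    (hgK : SpaceSupportedIn K g) (hh : ContDiffOn ℝ ∞ h slab) (hhK : SpaceSupportedIn K h)
    (hg1 : h1Sq g ≠ ⊤) (hh1 : h1Sq h ≠ ⊤) (ξ : Plane) :
    ‖𝓕 (bilinearTrace g h) ξ‖ₑ ≤ 5 * conv (majorant g) (majorant h) ξ := by
  rw [fourier_bilinearTrace hK hg hgK hh hhK hg1 hh1, conv, ← lintegral_const_mul' _ _ (by norm_num)]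
  exact (enorm_integral_le_lintegral_enorm _).trans (lintegral_mono fun η =>
    enorm_integral_sliceFourier_le hK hg hgK hh hhK _ _)

end SliceFourier
-- Littlewood-Paley projections against sharp frequency cutoffs.
section Besov

theorem enorm_fourier_le (f : Plane → ℂ) (ξ : Plane) : ‖𝓕 f ξ‖ₑ ≤ ENNReal.ofReal (∫ x, ‖f x‖) := by
  rw [← ofReal_norm]
  exact ENNReal.ofReal_le_ofReal (norm_fourier_le_integral_norm f ξ)

theorem eLpNorm_two_eq {f : Plane → ℂ} :
    eLpNorm f 2 volume = (∫⁻ x, ‖f x‖ₑ ^ 2) ^ (1 / 2 : ℝ) := by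
  rw [eLpNorm_eq_lintegral_rpow_enorm_toReal (by norm_num) (by norm_num)]
  simp

/-- The product `m · 𝓕 f` is bounded and lives on a set of finite measure, hence lies in `L¹ ∩ L²`,
where Plancherel applies to the inverse integral. -/
theorem eLpNorm_multiplier_le {m : Plane → ℝ} (hm : Measurable m) {M : ℝ≥0} (hM : ∀ ξ, |m ξ| ≤ M)
    {A : Set Plane} (hA : MeasurableSet A) (hAfin : volume A ≠ ⊤) (hmA : ∀ ξ, ξ ∉ A → m ξ = 0)
    {f : Plane → ℂ} (hf : Integrable f) :
    eLpNorm (𝓕⁻ fun ξ => (m ξ : ℂ) * 𝓕 f ξ) 2 volume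
      ≤ M * (∫⁻ ξ in A, ‖𝓕 f ξ‖ₑ ^ 2) ^ (1 / 2 : ℝ) := by
  have hcont := continuous_fourier_of_integrable hf
  have hmeas : Measurable fun ξ => (m ξ : ℂ) * 𝓕 f ξ := by fun_prop
  have hind : A.indicator (fun ξ => (m ξ : ℂ) * 𝓕 f ξ) = fun ξ => (m ξ : ℂ) * 𝓕 f ξ := by
    ext ξ
    by_cases h : ξ ∈ A
    · rw [indicator_of_mem h]
    · rw [indicator_of_notMem h, hmA ξ h, Complex.ofReal_zero, zero_mul]
  have hmem : ∀ p : ℝ≥0∞, MemLp (fun ξ => (m ξ : ℂ) * 𝓕 f ξ) p volume := fun p => by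
    rw [← hind, memLp_indicator_iff_restrict hA]
    have : IsFiniteMeasure (volume.restrict A) := ⟨by simpa using hAfin.lt_top⟩
    refine MemLp.of_bound hmeas.aestronglyMeasurable (M * ∫ x, ‖f x‖) (.of_forall fun ξ => ?_)
    rw [norm_mul, Complex.norm_real]
    exact mul_le_mul (hM ξ) (norm_fourier_le_integral_norm f ξ) (norm_nonneg _) M.2
  rw [eLpNorm_fourierInv (memLp_one_iff_integrable.1 (hmem 1)) (hmem 2), ← hind, eLpNorm_two_eq]
  have h0 : (0 : ℝ) ≤ 1 / 2 := by norm_num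
  have hsq : (M : ℝ≥0∞) = ((M : ℝ≥0∞) ^ 2) ^ (1 / 2 : ℝ) := by
    rw [← ENNReal.rpow_natCast, ← ENNReal.rpow_mul]; norm_num
  rw [hsq, ← ENNReal.mul_rpow_of_nonneg _ _ h0]
  refine ENNReal.rpow_le_rpow ?_ h0
  rw [← lintegral_const_mul' _ _ (by finiteness), ← lintegral_indicator hA]
  refine lintegral_mono fun ξ => ?_
  by_cases h : ξ ∈ A
  · rw [indicator_of_mem h, indicator_of_mem h, enorm_mul, mul_pow]
    gcongr
    rw [← ofReal_norm, Complex.norm_real, ← ENNReal.ofReal_coe_nnreal]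
    exact ENNReal.ofReal_le_ofReal (hM ξ)
  · simp [h]

variable {χ : Plane → ℝ}

theorem IsLPCutoff.exists_bound (hχ : IsLPCutoff χ) : ∃ M : ℝ≥0, ∀ ξ, |χ ξ| ≤ M := by
  have hs : HasCompactSupport χ := HasCompactSupport.intro (isCompact_closedBall (0 : Plane) 2)
    fun ξ hξ => by
      by_contra h
      exact hξ (by simpa using (hχ.support_subset h).2)
  obtain ⟨M, hM⟩ := hs.exists_bound_of_continuous hχ.smooth.continuous
  exact ⟨⟨M, (norm_nonneg _).trans (hM 0)⟩, hM⟩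

theorem IsLPCutoff.mem_of_ne_zero (hχ : IsLPCutoff χ) {k : ℤ} {ξ : Plane}
    (h : χ ((2 : ℝ) ^ (-k) • ξ) ≠ 0) : (2 : ℝ) ^ k ≤ 2 * ‖ξ‖ ∧ ‖ξ‖ ≤ 2 * (2 : ℝ) ^ k := by
  have hk : (0 : ℝ) < 2 ^ k := by positivity
  have := hχ.support_subset h
  rw [mem_ofPred_eq, norm_smul, zpow_neg, norm_inv, Real.norm_of_nonneg hk.le,
    inv_mul_le_iff₀ hk, le_inv_mul_iff₀ hk] at this
  exact ⟨by linarith [this.1], by linarith [this.2]⟩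

theorem IsLPCutoff.abs_lpSymbol_le (hχ : IsLPCutoff χ) {M : ℝ≥0} (hM : ∀ ξ, |χ ξ| ≤ M) (J : Set ℤ)
    (ξ : Plane) : |lpSymbol χ J ξ| ≤ 3 * M := by
  rcases eq_or_ne ξ 0 with rfl | hξ
  · have : lpSymbol χ J 0 = 0 := by
      have h0 : χ 0 = 0 := by
        by_contra h
        have := (hχ.support_subset h).1
        norm_num at this
      simp [lpSymbol, h0]
    rw [this, abs_zero]
    positivity
  · have hr : 0 < ‖ξ‖ := norm_pos_iff.2 hξ
    set n := Int.log 2 ‖ξ‖ with hn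
    have h1 : (2 : ℝ) ^ n ≤ ‖ξ‖ := by simpa using Int.zpow_log_le_self one_lt_two hr
    have h2 : ‖ξ‖ < (2 : ℝ) ^ (n + 1) := by simpa using Int.lt_zpow_succ_log_self one_lt_two ‖ξ‖
    -- With `2^n ≤ |ξ| < 2^{n+1}`, the support condition leaves only three dyadic indices, whence
    -- the bound `3 M` for every `J`.
    have hz : ∀ k ∉ Finset.Icc (n - 1) (n + 1),
        J.indicator (fun k : ℤ => χ ((2 : ℝ) ^ (-k) • ξ)) k = 0 := fun k hk => by
      by_contra h
      have hne : χ ((2 : ℝ) ^ (-k) • ξ) ≠ 0 := fun h0 => h (by simp only [indicator, h0, ite_self])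
      obtain ⟨a, b⟩ := hχ.mem_of_ne_zero hne
      have e1 : (2 : ℝ) ^ k < 2 ^ (n + 2) := by
        rw [show n + 2 = (n + 1) + 1 by ring, zpow_add_one₀ two_ne_zero (n + 1)]
        linarith
      have e2 : (2 : ℝ) ^ n ≤ 2 ^ (k + 1) := by
        rw [zpow_add_one₀ two_ne_zero]
        linarith
      rw [zpow_lt_zpow_iff_right₀ one_lt_two] at e1
      rw [zpow_le_zpow_iff_right₀ one_lt_two] at e2
      exact hk (Finset.mem_Icc.2 ⟨by omega, by omega⟩)
    have hsum : lpSymbol χ J ξ = ∑ k ∈ Finset.Icc (n - 1) (n + 1),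
        J.indicator (fun k : ℤ => χ ((2 : ℝ) ^ (-k) • ξ)) k := by
      rw [lpSymbol, tsum_subtype J fun k : ℤ => χ ((2 : ℝ) ^ (-k) • ξ), tsum_eq_sum hz]
    rw [hsum]
    refine (Finset.abs_sum_le_sum_abs _ _).trans ?_
    refine (Finset.sum_le_card_nsmul _ _ (M : ℝ) fun k _ => ?_).trans ?_
    · by_cases h : k ∈ J
      · rw [indicator_of_mem h]; exact hM _
      · rw [indicator_of_notMem h, abs_zero]; exact M.2
    · rw [Int.card_Icc, show n + 1 + 1 - (n - 1) = 3 by ring]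
      simp

theorem IsLPCutoff.measurable_lpSymbol (hχ : IsLPCutoff χ) (J : Set ℤ) :
    Measurable (lpSymbol χ J) := by
  have hc := hχ.smooth.continuous
  have hs : ∀ ξ, Summable fun k : ℤ => χ ((2 : ℝ) ^ (-k) • ξ) := fun ξ => by
    rcases eq_or_ne ξ 0 with rfl | hξ
    · have h0 : χ 0 = 0 := by
        by_contra h
        have := (hχ.support_subset h).1
        norm_num at this
      simp [h0]
    · exact (hχ.hasSum_one ξ hξ).summable
  refine measurable_of_tendsto_metrizable' (u := Filter.atTop)
    (f := fun (s : Finset J) ξ => ∑ k ∈ s, χ ((2 : ℝ) ^ (-(k : ℤ)) • ξ)) (fun s => ?_) ?_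
  · exact (continuous_finsetSum _ fun k _ => by fun_prop).measurable
  · rw [tendsto_pi_nhds]
    exact fun ξ => ((hs ξ).subtype J).hasSum

/-- The Besov norm with sharp frequency cutoffs, on the Fourier side. -/
def fourierBesov (f : Plane → ℂ) : ℝ≥0∞ :=
  ∑' k : ℕ, (∫⁻ ξ in annulus k, ‖𝓕 f ξ‖ₑ ^ 2) ^ (1 / 2 : ℝ)
    + (∫⁻ ξ in Metric.closedBall 0 1, ‖𝓕 f ξ‖ₑ ^ 2) ^ (1 / 2 : ℝ)

theorem volume_annulus_ne_top (k : ℕ) : volume (annulus k) ≠ ⊤ := by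
  refine ne_top_of_le_ne_top ?_ (volume_annulus_le k)
  have : volume (Metric.closedBall (0 : Plane) 1) ≠ ⊤ := (isCompact_closedBall _ _).measure_ne_top
  finiteness

theorem IsLPCutoff.besovNorm_le (hχ : IsLPCutoff χ) : ∃ M : ℝ≥0, ∀ f : Plane → ℂ, Integrable f →
    besovNorm χ 0 f ≤ M * fourierBesov f := by
  obtain ⟨M, hM⟩ := hχ.exists_bound
  refine ⟨3 * M, fun f hf => ?_⟩
  have hMJ : ∀ J ξ, |lpSymbol χ J ξ| ≤ (3 * M : ℝ≥0) := fun J ξ => by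
    simpa using hχ.abs_lpSymbol_le hM J ξ
  rw [besovNorm, fourierBesov, mul_add, ← ENNReal.tsum_mul_left]
  refine add_le_add (ENNReal.tsum_le_tsum fun k => ?_) ?_
  · rw [mul_zero, ENNReal.rpow_zero, one_mul]
    refine eLpNorm_multiplier_le (hχ.measurable_lpSymbol _) (hMJ _) (measurableSet_annulus k)
      (volume_annulus_ne_top k) (fun ξ hξ => ?_) hf
    rw [lpSymbol, tsum_singleton (k : ℤ) fun k : ℤ => χ ((2 : ℝ) ^ (-k) • ξ)]
    by_contra h
    exact hξ (by simpa [annulus] using hχ.mem_of_ne_zero h)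
  · refine eLpNorm_multiplier_le (hχ.measurable_lpSymbol _) (hMJ _)
      Metric.isClosed_closedBall.measurableSet (isCompact_closedBall _ _).measure_ne_top
      (fun ξ hξ => ?_) hf
    rw [lpSymbol]
    convert! tsum_zero with k
    by_contra h
    refine hξ (mem_closedBall_zero_iff.2 ((hχ.mem_of_ne_zero h).2.trans ?_))
    -- For `k ≤ -1` the support lies in `|ξ| ≤ 2 · 2^{-1} = 1`, the unit disc of `fourierBesov`.
    have hk : (k : ℤ) ≤ -1 := by have := k.2; simp only [mem_Iio] at this; omega
    have : (2 : ℝ) ^ (k : ℤ) ≤ 2 ^ (-1 : ℤ) := zpow_le_zpow_right₀ one_le_two hk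
    norm_num at this ⊢
    linarith

/-! ### Limits along cutoffs and the bound for the trace. -/

theorem tendsto_fourier {f : Plane → ℂ} (hf : Integrable f) {F : ℕ → Plane → ℂ}
    (hF : ∀ n, AEStronglyMeasurable (F n)) (hle : ∀ n x, ‖F n x‖ ≤ ‖f x‖)
    (hlim : ∀ x, Filter.Tendsto (fun n => F n x) Filter.atTop (nhds (f x))) (ξ : Plane) :
    Filter.Tendsto (fun n => 𝓕 (F n) ξ) Filter.atTop (nhds (𝓕 f ξ)) := by
  simp only [Real.fourier_eq]
  have hchar : Continuous fun x : Plane => Real.fourierChar (-inner ℝ x ξ) := by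
    have := Real.continuous_fourierChar
    fun_prop
  refine tendsto_integral_of_dominated_convergence (fun x => ‖f x‖)
    (fun n => hchar.aestronglyMeasurable.smul (hF n)) hf.norm
    (fun n => .of_forall fun x => ?_) (.of_forall fun x => (hlim x).const_smul _)
  rw [Circle.norm_smul]
  exact hle n x

theorem tendsto_setLIntegral_fourier_sq {f : Plane → ℂ} (hf : Integrable f) {F : ℕ → Plane → ℂ}
    (hF : ∀ n, AEStronglyMeasurable (F n)) (hle : ∀ n x, ‖F n x‖ ≤ ‖f x‖)
    (hlim : ∀ x, Filter.Tendsto (fun n => F n x) Filter.atTop (nhds (f x)))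
    {A : Set Plane} (hA : volume A ≠ ⊤) :
    Filter.Tendsto (fun n => (∫⁻ ξ in A, ‖𝓕 (F n) ξ‖ₑ ^ 2) ^ (1 / 2 : ℝ)) Filter.atTop
      (nhds ((∫⁻ ξ in A, ‖𝓕 f ξ‖ₑ ^ 2) ^ (1 / 2 : ℝ))) := by
  have hint : ∀ n, Integrable (F n) := fun n => hf.mono (hF n) (.of_forall (hle n))
  refine (ENNReal.continuous_rpow_const.tendsto _).comp ?_
  refine tendsto_lintegral_of_dominated_convergence (fun _ => ENNReal.ofReal (∫ x, ‖f x‖) ^ 2)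
    (fun n => ?_) (fun n => .of_forall fun ξ => ?_) ?_ (.of_forall fun ξ => ?_)
  · exact (continuous_fourier_of_integrable (hint n)).enorm.measurable.pow_const 2
  · refine pow_le_pow_left₀ zero_le ((enorm_fourier_le _ _).trans (ENNReal.ofReal_le_ofReal ?_)) 2
    exact integral_mono (hint n).norm hf.norm (hle n)
  · rw [setLIntegral_const]
    finiteness
  · exact (((ENNReal.continuous_pow 2).comp continuous_enorm).tendsto _).comp
      (tendsto_fourier hf hF hle hlim ξ)

/-- A Fatou property: each finite partial sum passes to the limit, as its terms are integrals over
sets of finite measure of transforms bounded by the `L¹` norm of `f`. -/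
theorem fourierBesov_le_of_tendsto {f : Plane → ℂ} (hf : Integrable f) {F : ℕ → Plane → ℂ}
    (hF : ∀ n, AEStronglyMeasurable (F n)) (hle : ∀ n x, ‖F n x‖ ≤ ‖f x‖)
    (hlim : ∀ x, Filter.Tendsto (fun n => F n x) Filter.atTop (nhds (f x)))
    {B : ℝ≥0∞} (hB : ∀ n, fourierBesov (F n) ≤ B) : fourierBesov f ≤ B := by
  rw [fourierBesov, ENNReal.tsum_eq_iSup_nat, ENNReal.iSup_add]
  refine iSup_le fun N => ?_
  refine le_of_tendsto (Filter.Tendsto.add (tendsto_finsetSum _ fun k _ =>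
    tendsto_setLIntegral_fourier_sq hf hF hle hlim (volume_annulus_ne_top k))
    (tendsto_setLIntegral_fourier_sq hf hF hle hlim (isCompact_closedBall _ _).measure_ne_top))
    (.of_forall fun n => ?_)
  exact (add_le_add (ENNReal.sum_le_tsum _) le_rfl).trans (hB n)

theorem besovNorm_zero (χ : Plane → ℝ) (θ : ℝ) : besovNorm χ θ 0 = 0 := by
  have hF : 𝓕 (0 : Plane → ℂ) = 0 := by
    ext ξ
    rw [Real.fourier_eq]
    simp
  have h : ∀ J, lpProj χ J 0 = 0 := fun J => by
    ext x
    rw [lpProj, Real.fourierInv_eq]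
    simp [hF]
  simp [besovNorm, h]

theorem fourierBesov_bilinearTrace_le_of_supported : ∃ C : ℝ≥0, ∀ (K : Set Plane)
    (g h : ℝ × Plane → ℂ), IsCompact K → ContDiffOn ℝ ∞ g slab → ContDiffOn ℝ ∞ h slab →
    SpaceSupportedIn K g → SpaceSupportedIn K h → h1Sq g ≠ ⊤ → h1Sq h ≠ ⊤ →
    fourierBesov (bilinearTrace g h) ≤ C * (h1Norm g * h1Norm h) := by
  obtain ⟨C, hC⟩ := tsum_conv_le
  have h0 : (0 : ℝ) ≤ 1 / 2 := by norm_num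
  refine ⟨5 * (C * (2 ^ (1 / 2 : ℝ) * 2 ^ (1 / 2 : ℝ))), fun K g h hK hg hh hgK hhK hg1 hh1 => ?_⟩
  have hmono : ∀ A : Set Plane, (∫⁻ ξ in A, ‖𝓕 (bilinearTrace g h) ξ‖ₑ ^ 2) ^ (1 / 2 : ℝ)
      ≤ 5 * (∫⁻ ξ in A, conv (majorant g) (majorant h) ξ ^ 2) ^ (1 / 2 : ℝ) := fun A => by
    have h5 : (5 : ℝ≥0∞) = (5 ^ 2) ^ (1 / 2 : ℝ) := by
      rw [← ENNReal.rpow_natCast, ← ENNReal.rpow_mul]; norm_num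
    rw [h5, ← ENNReal.mul_rpow_of_nonneg _ _ h0, ← lintegral_const_mul' _ _ (by finiteness)]
    refine ENNReal.rpow_le_rpow (lintegral_mono fun ξ => ?_) h0
    rw [← mul_pow]
    exact pow_le_pow_left₀ zero_le
      (enorm_fourier_bilinearTrace_le hK hg hgK hh hhK hg1 hh1 ξ) 2
  calc fourierBesov (bilinearTrace g h)
      ≤ 5 * (∑' k : ℕ, (∫⁻ ξ in annulus k, conv (majorant g) (majorant h) ξ ^ 2) ^ (1 / 2 : ℝ)
        + (∫⁻ ξ in Metric.closedBall 0 1, conv (majorant g) (majorant h) ξ ^ 2) ^ (1 / 2 : ℝ)) := by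
        rw [mul_add, ← ENNReal.tsum_mul_left]
        exact add_le_add (ENNReal.tsum_le_tsum fun k => hmono _) (hmono _)
    _ ≤ 5 * (C * ((2 * h1Sq g) ^ (1 / 2 : ℝ) * (2 * h1Sq h) ^ (1 / 2 : ℝ))) := by
        refine mul_le_mul_right ((hC _ _ (measurable_majorant hK hg hgK)
          (measurable_majorant hK hh hhK)).trans (mul_le_mul_right (mul_le_mul' ?_ ?_) _)) _
        · exact ENNReal.rpow_le_rpow (halfNormSq_majorant_le hK hg hgK) h0
        · exact ENNReal.rpow_le_rpow (halfNormSq_majorant_le hK hh hhK) h0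
    _ = _ := by
        rw [h1Norm_eq, h1Norm_eq]
        simp only [ENNReal.mul_rpow_of_nonneg _ _ h0]
        push_cast [ENNReal.coe_rpow_of_nonneg _ h0]
        ring

theorem fourierBesov_bilinearTrace_le : ∃ C : ℝ≥0, ∀ g h : ℝ × Plane → ℂ,
    ContDiffOn ℝ ∞ g slab → ContDiffOn ℝ ∞ h slab → h1Sq g ≠ ⊤ → h1Sq h ≠ ⊤ →
    fourierBesov (bilinearTrace g h) ≤ C * (h1Norm g * h1Norm h) := by
  obtain ⟨C, hC⟩ := fourierBesov_bilinearTrace_le_of_supported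
  obtain ⟨φ, L, hφ, hφK, hφ1, hφL, hφlim⟩ := exists_cutoffs
  have h0 : (0 : ℝ) ≤ 1 / 2 := by norm_num
  refine ⟨C * ((2 + 4 * L ^ 2) ^ (1 / 2 : ℝ) * (2 + 4 * L ^ 2) ^ (1 / 2 : ℝ)),
    fun g h hg hh hg1 hh1 => ?_⟩
  have hf := integrable_bilinearTrace hg hh hg1 hh1
  have hnorm : ∀ (q : ℝ × Plane → ℂ), ContDiffOn ℝ ∞ q slab → ∀ n,
      h1Norm (mulX (φ n) q) ≤ (2 + 4 * (L : ℝ≥0∞) ^ 2) ^ (1 / 2 : ℝ) * h1Norm q := fun q hq n => by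
    rw [h1Norm_eq, h1Norm_eq, ← ENNReal.mul_rpow_of_nonneg _ _ h0]
    exact ENNReal.rpow_le_rpow (h1Sq_mulX_le (hφ n) hq (hφ1 n) (hφL n)) h0
  have hfin : ∀ (q : ℝ × Plane → ℂ), ContDiffOn ℝ ∞ q slab → h1Sq q ≠ ⊤ → ∀ n,
      h1Sq (mulX (φ n) q) ≠ ⊤ := fun q hq hq1 n =>
    ne_top_of_le_ne_top (by finiteness) (h1Sq_mulX_le (hφ n) hq (hφ1 n) (hφL n))
  have hsupp : ∀ (q : ℝ × Plane → ℂ) n, SpaceSupportedIn (tsupport (φ n)) (mulX (φ n) q) :=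
    fun q n p _ hp => by
      rw [mulX, image_eq_zero_of_notMem_tsupport hp, Complex.ofReal_zero, zero_mul]
  have heq : ∀ n, bilinearTrace (mulX (φ n) g) (mulX (φ n) h)
      = fun x => (φ n x : ℂ) ^ 2 * bilinearTrace g h x := fun n =>
    funext (bilinearTrace_mulX (φ n) g h)
  refine fourierBesov_le_of_tendsto hf
    (F := fun n => bilinearTrace (mulX (φ n) g) (mulX (φ n) h)) (fun n => ?_) (fun n x => ?_)
    (fun x => ?_) fun n => ?_
  · rw [heq]
    have := (hφ n).continuous
    exact Continuous.aestronglyMeasurable (by fun_prop) |>.mul hf.aestronglyMeasurable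
  · rw [heq, norm_mul, norm_pow, Complex.norm_real]
    exact mul_le_of_le_one_left (norm_nonneg _) (pow_le_one₀ (norm_nonneg _) (hφ1 n x))
  · simp only [heq]
    have h1 : Filter.Tendsto (fun n => (φ n x : ℂ)) Filter.atTop (nhds ((1 : ℝ) : ℂ)) :=
      (Complex.continuous_ofReal.tendsto _).comp (hφlim x)
    simpa using (h1.pow 2).mul_const (bilinearTrace g h x)
  · refine (hC _ _ _ (hφK n) (contDiffOn_mulX (hφ n) hg) (contDiffOn_mulX (hφ n) hh) (hsupp g n)
      (hsupp h n) (hfin g hg hg1 n) (hfin h hh hh1 n)).trans ?_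
    refine (mul_le_mul_right (mul_le_mul' (hnorm g hg n) (hnorm h hh n)) _).trans (le_of_eq ?_)
    push_cast [ENNReal.coe_rpow_of_nonneg _ h0]
    ring

end Besov
end SharpTrace

end

theorem proposition1p2 (χ : SharpTrace.Plane → ℝ) (hχ : SharpTrace.IsLPCutoff χ) :
    ∃ C : ℝ≥0, ∀ g h : ℝ × SharpTrace.Plane → ℂ,
      ContDiffOn ℝ ∞ g SharpTrace.slab → ContDiffOn ℝ ∞ h SharpTrace.slab →
        (SharpTrace.h1Norm g ≠ ⊤ → SharpTrace.h1Norm h ≠ ⊤ →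
          Integrable (SharpTrace.bilinearTrace g h) volume) ∧
        SharpTrace.besovNorm χ 0 (SharpTrace.bilinearTrace g h) ≤
          (C : ℝ≥0∞) * SharpTrace.h1Norm g * SharpTrace.h1Norm h := by
  open SharpTrace in
  obtain ⟨M, hM⟩ := hχ.besovNorm_le
  obtain ⟨C, hC⟩ := fourierBesov_bilinearTrace_le
  have hzero : ∀ q : ℝ × Plane → ℂ, h1Norm q = 0 ↔ h1Sq q = 0 := fun q => by
    rw [h1Norm_eq, ENNReal.rpow_eq_zero_iff_of_pos (by norm_num)]
  have hone : ((M * C + 1 : ℝ≥0) : ℝ≥0∞) ≠ 0 := by simp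
  -- The added `1` keeps the constant nonzero, so that the right-hand side is `⊤` when one norm is
  -- infinite and the other is nonzero.
  refine ⟨M * C + 1, fun g h hg hh => ⟨fun hg1 hh1 => integrable_bilinearTrace hg hh
    (h1Norm_ne_top_iff.1 hg1) (h1Norm_ne_top_iff.1 hh1), ?_⟩⟩
  by_cases hg0 : h1Norm g = 0
  · rw [bilinearTrace_eq_zero_left hg ((hzero g).1 hg0), besovNorm_zero]
    exact zero_le
  by_cases hh0 : h1Norm h = 0
  · rw [bilinearTrace_eq_zero_right hh ((hzero h).1 hh0), besovNorm_zero]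
    exact zero_le
  by_cases hg1 : h1Norm g = ⊤
  · rw [hg1, ENNReal.mul_top hone, ENNReal.top_mul hh0]
    exact le_top
  by_cases hh1 : h1Norm h = ⊤
  · rw [hh1, ENNReal.mul_top (mul_ne_zero hone hg0)]
    exact le_top
  have hg2 := h1Norm_ne_top_iff.1 hg1
  have hh2 := h1Norm_ne_top_iff.1 hh1
  calc besovNorm χ 0 (bilinearTrace g h)
      ≤ M * fourierBesov (bilinearTrace g h) := hM _ (integrable_bilinearTrace hg hh hg2 hh2)
    _ ≤ M * (C * (h1Norm g * h1Norm h)) := mul_le_mul_right (hC g h hg hh hg2 hh2) _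
    _ = (M * C : ℝ≥0) * h1Norm g * h1Norm h := by push_cast; ring
    _ ≤ _ := by
        gcongr
        exact le_self_add
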